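/- Let $(x_1,\dots,x_8)$ be coordinates on $\mathbb{R}^8$ with Euclidean metric $g_0$, write $d\mathbf{x}_{ijkl}=dx_i\wedge dx_j\wedge dx_k\wedge dx_l$, and let \begin{align*}\Phi_0={}& d\mathbf{x}_{1234}+d\mathbf{x}_{1256}+d\mathbf{x}_{1278}+d\mathbf{x}_{1357}-d\mathbf{x}_{1368}-d\mathbf{x}_{1458}-d\mathbf{x}_{1467}\\&+d\mathbf{x}_{5678}+d\mathbf{x}_{3478}+d\mathbf{x}_{3456}+d\mathbf{x}_{2468}-d\mathbf{x}_{2457}-d\mathbf{x}_{2367}-d\mathbf{x}_{2358}.\end{align*} For a 3-vector $\xi\in\Lambda^3\mathbb{R}^8$ let $\xi^{abc}(\Phi_0)_{abcd}(g_0)^{de}$ denote the vector that depends linearly on $\xi$ and is, for $\xi=u\wedge v\wedge w$, the vector $z$ with $g_0(z,y)=\Phi_0(u,v,w,y)$ for all $y\in\mathbb{R}^8$. An immersed Cayley 4-fold is an immersion of an oriented 4-manifold into $\mathbb{R}^8$ such that $\Phi_0$ restricts to the induced volume form on every tangent plane of the image; it is embedded if the immersion is an embedding. Let $P$ be a compact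 real analytic 3-manifold (Hausdorff, without boundary), $\chi$ a real analytic nowhere vanishing section of $\Lambda^3TP$ (so that $P$ is orientable), and $\psi:P\to\mathbb{R}^8$ a real analytic immersion. Then there exist $\epsilon>0$ and a unique real analytic family $\{\psi_t:t\in(-\epsilon,\epsilon)\}$ of maps $\psi_t:P\to\mathbb{R}^8$ (that is, $\Psi:(-\epsilon,\epsilon)\times P\to\mathbb{R}^8$, $\Psi(t,p)=\psi_t(p)$, is real analytic) with $\psi_0=\psi$ and $$\left(\frac{d\psi_t}{dt}\right)^e=(\psi_t)_*(\chi)^{abc}(\Phi_0)_{abcd}(g_0)^{de}\qquad\text{for all }t\in(-\epsilon,\epsilon),$$ and, for this $\epsilon$, $M=\operatorname{Image}\Psi$ is a nonsingular immersed Cayley 4-fold in $\mathbb{R}^8$, with immersion $\Psi$. If $\psi$ is moreover an embedding, then $\epsilon$ can be chosen so that, in addition, $M$ is a nonsingular embedded Cayley 4-fold, with embedding $\Psi$. -/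

import Mathlib

open Set Filter Topology
open scoped Manifold ContDiff

/-- `ℝ³`, the model space of a 3-dimensional manifold. -/
abbrev E3 : Type := EuclideanSpace ℝ (Fin 3)

/-- `ℝ⁸` with its Euclidean metric. -/
abbrev E8 : Type := EuclideanSpace ℝ (Fin 8)

/-- The constant 4-form `dxᵢ ∧ dxⱼ ∧ dxₖ ∧ dxₗ` on `ℝ⁸` (coordinates are numbered from 0):
`(v₀, v₁, v₂, v₃) ↦ det (dx_{s b} (v_a))_{a, b}` with `s = (i, j, k, l)`. -/
noncomputable def dx4 (i j k l : Fin 8) : E8 [⋀^Fin 4]→ₗ[ℝ] ℝ :=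
  (Matrix.detRowAlternating (n := Fin 4) (R := ℝ)).compLinearMap
    (LinearMap.pi fun b : Fin 4 => (EuclideanSpace.proj (![i, j, k, l] b) : E8 →L[ℝ] ℝ).toLinearMap)

theorem dx4_apply (i j k l : Fin 8) (v : Fin 4 → E8) :
    dx4 i j k l v = Matrix.det (Matrix.of fun a b : Fin 4 => v a (![i, j, k, l] b)) :=
  rfl

/-- The `Spin(7)` 4-form `Φ₀` on `ℝ⁸`. The usual coordinates `x₁, …, x₈` are
the coordinates `0, …, 7` here. -/
noncomputable def Phi0 : E8 [⋀^Fin 4]→ₗ[ℝ] ℝ :=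
  dx4 0 1 2 3 + dx4 0 1 4 5 + dx4 0 1 6 7 + dx4 0 2 4 6
    - dx4 0 2 5 7 - dx4 0 3 4 7 - dx4 0 3 5 6
    + dx4 4 5 6 7 + dx4 2 3 6 7 + dx4 2 3 4 5 + dx4 1 3 5 7
    - dx4 1 3 4 6 - dx4 1 2 5 6 - dx4 1 2 4 7

/-- The 3-form `Φ₀(·, ·, ·, y)`, with `y` in the last slot. -/
noncomputable def Phi0Last (y : E8) : E8 [⋀^Fin 3]→ₗ[ℝ] ℝ := -(Phi0.curryLeft y)

theorem neg_curryLeft_apply_last (φ : E8 [⋀^Fin 4]→ₗ[ℝ] ℝ) (y u v w : E8) :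
    (-(φ.curryLeft y)) ![u, v, w] = φ ![u, v, w, y] := by
  have key : φ (![y, u, v, w] ∘ finRotate 4) = - φ ![y, u, v, w] := by
    rw [AlternatingMap.map_perm, sign_finRotate]
    simp [pow_succ]
  have hrot : (![y, u, v, w] ∘ finRotate 4) = ![u, v, w, y] := by
    funext i
    fin_cases i <;> rfl
  rw [hrot] at key
  rw [key, AlternatingMap.neg_apply, AlternatingMap.curryLeft_apply_apply]

theorem Phi0Last_apply (y u v w : E8) : Phi0Last y ![u, v, w] = Phi0 ![u, v, w, y] :=
  neg_curryLeft_apply_last Phi0 y u v w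

/-- The contraction of a 3-vector `ξ` on `ℝ⁸` with `Φ₀`, turned into a vector by the
Euclidean metric: `ξ^{abc} (Φ₀)_{abcd} (g₀)^{de}`. On a decomposable 3-vector `u ∧ v ∧ w` it is
the vector `z` with `⟨z, y⟩ = Φ₀(u, v, w, y)` for all `y`, see `contractPhi0_wedge`. -/
noncomputable def contractPhi0 (ξ : ⋀[ℝ]^3 E8) : E8 :=
  WithLp.toLp 2 fun e : Fin 8 =>
    exteriorPower.alternatingMapLinearEquiv (Phi0Last (EuclideanSpace.single e 1)) ξ

theorem contractPhi0_wedge (u v w : E8) (e : Fin 8) :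
    contractPhi0 (exteriorPower.ιMulti ℝ 3 ![u, v, w]) e =
      Phi0 ![u, v, w, EuclideanSpace.single e 1] := by
  simp [contractPhi0, Phi0Last_apply]

section Manifold

variable {P : Type*} [TopologicalSpace P] [ChartedSpace E3 P]

/-- The push-forward `f_* ξ ∈ Λ³ ℝ⁸` of a 3-vector `ξ ∈ Λ³ T_pP` under `f : P → ℝ⁸`. -/
noncomputable def pushforward3 (f : P → E8) (p : P)
    (ξ : ⋀[ℝ]^3 (TangentSpace 𝓘(ℝ, E3) p)) : ⋀[ℝ]^3 E8 :=
  exteriorPower.map (M := TangentSpace 𝓘(ℝ, E3) p) (N := E8) 3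
    (mfderiv 𝓘(ℝ, E3) 𝓘(ℝ, E8) f p).toLinearMap ξ

/-- The coefficient `c` of a 3-vector `c • (e₁ ∧ e₂ ∧ e₃)` on `ℝ³`. -/
noncomputable def coeff3 : ⋀[ℝ]^3 E3 →ₗ[ℝ] ℝ :=
  exteriorPower.alternatingMapLinearEquiv (EuclideanSpace.basisFun (Fin 3) ℝ).toBasis.det

/-- A section `χ` of `Λ³ TP` is real analytic: in every preferred chart `(x₁, x₂, x₃)`,
the function `c` with `χ = c ∂₁ ∧ ∂₂ ∧ ∂₃` is real analytic. -/
def IsAnalyticSection (χ : (p : P) → ⋀[ℝ]^3 (TangentSpace 𝓘(ℝ, E3) p)) : Prop :=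
  ∀ q : P, ContMDiffOn 𝓘(ℝ, E3) 𝓘(ℝ, ℝ) ω
    (fun p => coeff3 (exteriorPower.map (M := TangentSpace 𝓘(ℝ, E3) p) (N := E3) 3
      (mfderiv 𝓘(ℝ, E3) 𝓘(ℝ, E3) (extChartAt 𝓘(ℝ, E3) q) p).toLinearMap (χ p)))
    (chartAt E3 q).source

/-- `{ψ_t : t ∈ (-ε, ε)}` is a real analytic family of maps `P → ℝ⁸` with `ψ_0 = ψ₀` that
satisfies `(dψ_t/dt)^e = (ψ_t)_*(χ)^{abc} (Φ₀)_{abcd} (g₀)^{de}`. Values of `ψ` at times outside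
`(-ε, ε)` play no role. -/
structure IsCayleyEvolution (χ : (p : P) → ⋀[ℝ]^3 (TangentSpace 𝓘(ℝ, E3) p)) (ψ₀ : P → E8)
    (ε : ℝ) (ψ : ℝ → P → E8) : Prop where
  analytic : ContMDiffOn (𝓘(ℝ, ℝ).prod 𝓘(ℝ, E3)) 𝓘(ℝ, E8) ω
    (fun x : ℝ × P => ψ x.1 x.2) (Ioo (-ε) ε ×ˢ univ)
  initial : ψ 0 = ψ₀
  evolution : ∀ t ∈ Ioo (-ε) ε, ∀ p : P,
    HasDerivAt (fun s => ψ s p) (contractPhi0 (pushforward3 (ψ t) p (χ p))) t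

end Manifold

section Calibrated

variable {E H N : Type*} [NormedAddCommGroup E] [NormedSpace ℝ E] [TopologicalSpace H]
  [TopologicalSpace N] [ChartedSpace H N]

/-- `o` is an orientation of the open subset `U` of the manifold `N` (of dimension `k`): it
orients each tangent space, and around each point of `U` there is a continuous local frame that
is positively oriented. -/
def IsOrientationOn (I : ModelWithCorners ℝ E H) [IsManifold I 1 N] {k : ℕ} (U : Set N)
    (o : (x : N) → Orientation ℝ (TangentSpace I x) (Fin k)) : Prop :=
  ∀ x₀ ∈ U, ∃ V ∈ 𝓝 x₀, ∃ b : (x : N) → Module.Basis (Fin k) ℝ (TangentSpace I x),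
    (∀ i, ContinuousOn (fun x => (⟨x, b x i⟩ : TangentBundle I N)) V) ∧
    ∀ x ∈ V, (b x).orientation = o x

/-- `F : U → ℝ⁸` is an immersed (nonsingular) Cayley 4-fold, for an open subset `U` of a manifold
`N` of dimension 4: `F` is a smooth immersion and for some orientation of `U`,
`Φ₀` restricts to the volume form on each tangent plane `dF(T_xN)`, `x ∈ U`, i.e. takes the value
1 on each positively oriented orthonormal basis of that plane. -/
structure IsImmersedCayleyOn (I : ModelWithCorners ℝ E H) [IsManifold I 1 N] (F : N → E8)
    (U : Set N) : Prop where
  isOpen : IsOpen U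
  finrank_eq : Module.finrank ℝ E = 4
  smooth : ContMDiffOn I 𝓘(ℝ, E8) ∞ F U
  immersion : ∀ x ∈ U, Function.Injective (mfderiv I 𝓘(ℝ, E8) F x)
  calibrated : ∃ o : (x : N) → Orientation ℝ (TangentSpace I x) (Fin 4),
    IsOrientationOn I U o ∧
    ∀ x ∈ U, ∀ b : Module.Basis (Fin 4) ℝ (TangentSpace I x), b.orientation = o x →
      ∀ v : Fin 4 → E8, (∀ i, v i = mfderiv I 𝓘(ℝ, E8) F x (b i)) → Orthonormal ℝ v →
        Phi0 v = 1

/-- `F : U → ℝ⁸` is an embedded Cayley 4-fold: an immersed one that is moreover a homeomorphism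
onto its image. -/
structure IsEmbeddedCayleyOn (I : ModelWithCorners ℝ E H) [IsManifold I 1 N] (F : N → E8)
    (U : Set N) : Prop extends IsImmersedCayleyOn I F U where
  embedding : IsEmbedding (U.domRestrict F)

end Calibrated

/-!
In a chart of `P`, with `χ = c ∂₁ ∧ ∂₂ ∧ ∂₃`, the evolution equation reads
`∂ₜψ = c(x) ∂₁ψ × ∂₂ψ × ∂₃ψ`, where `u × v × w` is the triple cross product defined by `Φ₀`
(`contractPhi0_pushforward3`). The right-hand side is analytic in `x` and cubic in the space
derivatives, so this is an equation of Cauchy–Kovalevskaya type. Neither the Cauchy–Kovalevskaya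
theorem nor the norms used to prove it are in Mathlib; both are developed here, for equations
`∂ₜU = c(x) S(T(∂ₓU, ∂ₓU), ∂ₓU)` with `S` and `T` bilinear.

*Existence* (`exists_cauchyKovalevskaya`). Write `U = ∑ tⁿ uₙ(x)`; the equation determines `uₙ₊₁`
from `u₀, …, uₙ`. Convergence is measured by the norm `∑ₖ sᵏ ‖Dᵏf(x₀)‖ / k!` of the Taylor series
at the single point `x₀` (`taylorNorm`). It is submultiplicative, and a derivative
costs a factor `1 / (s' - s)` when the radius `s'` is reduced to `s`. For radii `s < R`, the norm of
`∂ₓuₙ` at radius `s` is at most `Mₙ (R - s)⁻ⁿ`, where `Mₙ₊₁ = A ∑ Mᵢ Mⱼ Mₖ`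
(`taylorNorm_coeff_le`), and `Mₙ` grows at most geometrically
(`exists_summable_of_cubic_recursion`).

*Uniqueness* (`eqOn_of_cauchyKovalevskaya`). If the difference `w` of two solutions vanishes
to order `n` in time at time zero, then so does `∂ₓw`, hence by the equation also `∂ₜw`, so that `w`
vanishes to order `n + 1`. Therefore `w` vanishes to infinite order, and `w = 0` by analyticity in
time.

Since solutions are unique on every open subset of `P`, the local solutions over a finite cover of
the compact manifold `P` glue to an evolution (`exists_isCayleyEvolution`).

*Calibration.* The vector `z = u × v × w` is orthogonal to `u, v, w`, and its length is the volume
`|u ∧ v ∧ w|` (`inner_tripleCross_self`). Hence `u, v, w, z` are linearly independent if `u, v, w`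
are, and `Φ₀(u, v, w, z) = |z|²` is the volume of `u ∧ v ∧ w ∧ z`: their span is a Cayley plane
(`Phi0_sq_eq_one_of_orthonormal`). The tangent spaces of the evolution are of this form as long as
`ψ_t` is an immersion, as `∂ₜψ` is a non-zero multiple of the cross product of the images of a
basis of the tangent space of `P`. By compactness `ψ_t` is an immersion for small `t`. The
orientation is the one for which the pull-back of `Φ₀` is positive
(`isOrientationOn_pullbackOrientation`).

*Embedding.* If `ψ_0` is injective, then so is `(t, p) ↦ ψ_t(p)` for small times
(`IsCayleyEvolution.exists_injOn`), and on a smaller compact time interval it is a closed embedding.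
-/

/-! ### The Taylor norm -/

section TaylorNorm

open scoped NNReal ENNReal Nat

variable {E F G H : Type*} [NormedAddCommGroup E] [NormedSpace ℝ E] [NormedAddCommGroup F]
  [NormedSpace ℝ F] [NormedAddCommGroup G] [NormedSpace ℝ G] [NormedAddCommGroup H]
  [NormedSpace ℝ H]

/-- The Wiener-type norm `∑ₖ sᵏ ‖Dᵏf(x)‖ / k!` of the Taylor series of `f` at `x`, with values in
`[0, ∞]`. -/
noncomputable def taylorNorm (s : ℝ≥0) (f : E → F) (x : E) : ℝ≥0∞ :=
  ∑' k : ℕ, ((s ^ k / k ! : ℝ≥0) : ℝ≥0∞) * ‖iteratedFDeriv ℝ k f x‖ₑ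

theorem taylorNorm_mono {s s' : ℝ≥0} (h : s ≤ s') (f : E → F) (x : E) :
    taylorNorm s f x ≤ taylorNorm s' f x := by
  unfold taylorNorm
  gcongr

theorem taylorNorm_congr {s : ℝ≥0} {f g : E → F} {x : E} (h : f =ᶠ[𝓝 x] g) :
    taylorNorm s f x = taylorNorm s g x := by
  unfold taylorNorm
  congr 1 with k
  rw [(h.iteratedFDeriv ℝ k).eq_of_nhds]

theorem taylorNorm_le_of_iteratedFDeriv_le {s : ℝ≥0} {f : E → F} {g : G → H} {x : E} {y : G}
    (h : ∀ k, ‖iteratedFDeriv ℝ k f x‖ ≤ ‖iteratedFDeriv ℝ k g y‖) :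
    taylorNorm s f x ≤ taylorNorm s g y := by
  refine ENNReal.tsum_le_tsum fun k => ?_
  gcongr
  exact enorm_le_iff_norm_le.2 (h k)

theorem taylorNorm_sum_le [CompleteSpace F] {ι : Type*} {s : ℝ≥0} {t : Finset ι}
    {f : ι → E → F} {x : E}
    (h : ∀ i ∈ t, AnalyticAt ℝ (f i) x) :
    taylorNorm s (fun y => ∑ i ∈ t, f i y) x ≤ ∑ i ∈ t, taylorNorm s (f i) x := by
  unfold taylorNorm
  rw [← Summable.tsum_finsetSum fun i _ => ENNReal.summable]
  refine ENNReal.tsum_le_tsum fun k => ?_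
  rw [iteratedFDeriv_fun_sum_apply fun i hi => (h i hi).contDiffAt, ← Finset.mul_sum]
  gcongr
  exact enorm_sum_le t fun i => iteratedFDeriv ℝ k (f i) x

theorem taylorNorm_const_smul [CompleteSpace F] {s : ℝ≥0} {f : E → F} {x : E} (a : ℝ)
    (h : AnalyticAt ℝ f x) :
    taylorNorm s (fun y => a • f y) x = ‖a‖ₑ * taylorNorm s f x := by
  unfold taylorNorm
  rw [← ENNReal.tsum_mul_left]
  congr 1 with k
  rw [iteratedFDeriv_const_smul_apply' h.contDiffAt, enorm_smul]
  ring

theorem norm_iteratedFDeriv_le_of_bilinear_of_analyticAt [CompleteSpace F] [CompleteSpace G]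
    (B : F →L[ℝ] G →L[ℝ] H) {f : E → F}
    {g : E → G} {x : E} (hf : AnalyticAt ℝ f x) (hg : AnalyticAt ℝ g x) (n : ℕ) :
    ‖iteratedFDeriv ℝ n (fun y => B (f y) (g y)) x‖ ≤ ‖B‖ * ∑ i ∈ Finset.range (n + 1),
      (n.choose i : ℝ) * ‖iteratedFDeriv ℝ i f x‖ * ‖iteratedFDeriv ℝ (n - i) g x‖ := by
  obtain ⟨u, hu, hfg⟩ := ((hf.contDiffAt (n := ω)).eventually (by simp)).and
    ((hg.contDiffAt (n := ω)).eventually (by simp)) |>.exists_mem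
  obtain ⟨v, hvu, hv, hxv⟩ := mem_nhds_iff.1 hu
  have := B.norm_iteratedFDerivWithin_le_of_bilinear (N := ω) (s := v) (x := x) (n := n)
    (fun y hy => (hfg y (hvu hy)).1.contDiffWithinAt)
    (fun y hy => (hfg y (hvu hy)).2.contDiffWithinAt) hv.uniqueDiffOn hxv (by simp)
  simpa only [iteratedFDerivWithin_of_isOpen _ hv hxv] using this

theorem ennreal_tsum_mul_tsum_eq_tsum_sum_antidiagonal (a b : ℕ → ℝ≥0∞) :
    (∑' n, a n) * ∑' n, b n = ∑' n, ∑ p ∈ Finset.HasAntidiagonal.antidiagonal n, a p.1 * b p.2 := by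
  conv_rhs => congr; ext; rw [← Finset.sum_finset_coe, ← tsum_fintype (L := .unconditional _)]
  rw [← ENNReal.tsum_sigma'
    (β := fun n : ℕ => (Finset.HasAntidiagonal.antidiagonal n : Set (ℕ × ℕ)))
    (fun p : (Σ n : ℕ, (Finset.HasAntidiagonal.antidiagonal n : Set (ℕ × ℕ))) =>
      a (p.2 : ℕ × ℕ).1 * b (p.2 : ℕ × ℕ).2)]
  refine Eq.trans ?_ (Finset.HasAntidiagonal.sigmaAntidiagonalEquivProd.tsum_eq
    (fun p : ℕ × ℕ => a p.1 * b p.2)).symm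
  rw [ENNReal.tsum_prod (f := fun i j => a i * b j)]
  simp_rw [ENNReal.tsum_mul_left, ENNReal.tsum_mul_right]

/-- The Taylor norm is submultiplicative, by the Leibniz rule. -/
theorem taylorNorm_bilinear_le [CompleteSpace F] [CompleteSpace G]
    (B : F →L[ℝ] G →L[ℝ] H) {s : ℝ≥0} {f : E → F} {g : E → G} {x : E}
    (hf : AnalyticAt ℝ f x) (hg : AnalyticAt ℝ g x) :
    taylorNorm s (fun y => B (f y) (g y)) x ≤ ‖B‖ₑ * (taylorNorm s f x * taylorNorm s g x) := by
  unfold taylorNorm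
  rw [ennreal_tsum_mul_tsum_eq_tsum_sum_antidiagonal, ← ENNReal.tsum_mul_left]
  refine ENNReal.tsum_le_tsum fun n => ?_
  have h := norm_iteratedFDeriv_le_of_bilinear_of_analyticAt B hf hg n
  rw [← Finset.Nat.sum_antidiagonal_eq_sum_range_succ
    (fun i j => (n.choose i : ℝ) * ‖iteratedFDeriv ℝ i f x‖ * ‖iteratedFDeriv ℝ j g x‖)] at h
  simp only [enorm_eq_nnnorm]
  norm_cast
  rw [← NNReal.coe_le_coe]
  push_cast
  calc _ ≤ ((s : ℝ) ^ n / n !) * _ := mul_le_mul_of_nonneg_left h (by positivity)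
    _ = _ := by
      rw [mul_left_comm, Finset.mul_sum]
      congr 1
      refine Finset.sum_congr rfl fun p hp => ?_
      obtain ⟨i, j⟩ := p
      obtain rfl : i + j = n := by simpa using hp
      have h1 := Nat.add_choose_mul_factorial_mul_factorial i j
      have h2 : (((i + j).choose i : ℕ) : ℝ) * i ! * j ! = (i + j)! := by
        rw [Nat.choose_symm_add]
        exact_mod_cast h1
      have := Nat.factorial_ne_zero i
      have := Nat.factorial_ne_zero j
      have := Nat.factorial_ne_zero (i + j)
      field_simp
      rw [← h2]
      ring

/-- Cauchy's estimate: differentiating costs the inverse of the loss of radius. -/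
theorem taylorNorm_fderiv_le {s s' : ℝ≥0} (h : s ≤ s') (f : E → F) (x : E) :
    ((s' - s : ℝ≥0) : ℝ≥0∞) * taylorNorm s (fderiv ℝ f) x ≤ taylorNorm s' f x := by
  obtain ⟨d, rfl⟩ := exists_add_of_le h
  rw [add_tsub_cancel_left]
  have hbern (m : ℕ) : (s : ℝ) ^ (m + 1) + (m + 1 : ℝ) * (s : ℝ) ^ m * d ≤
      ((s : ℝ) + d) ^ (m + 1) := by
    induction m with
    | zero => simp
    | succ m ih =>
      have h1 := mul_le_mul_of_nonneg_right ih (show (0 : ℝ) ≤ s + d by positivity)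
      have h2 : (0 : ℝ) ≤ (m + 1) * (s : ℝ) ^ m * d * d := by positivity
      push_cast
      calc _ ≤ ((s : ℝ) ^ (m + 1) + (m + 1 : ℝ) * (s : ℝ) ^ m * d) * (s + d) := by
            ring_nf at h2 ⊢; linarith
        _ ≤ _ := by rw [pow_succ _ (m + 1)]; exact h1
  have hterm (k : ℕ) : d * (s ^ k / k !) ≤ (s + d) ^ (k + 1) / (k + 1)! := by
    rw [← NNReal.coe_le_coe]
    push_cast [Nat.factorial_succ]
    have h1 : (k + 1 : ℝ) * (s : ℝ) ^ k * d ≤ ((s : ℝ) + d) ^ (k + 1) :=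
      le_trans (le_add_of_nonneg_left (by positivity)) (hbern k)
    have h3 : (0 : ℝ) < k ! := by exact_mod_cast Nat.factorial_pos k
    rw [mul_div_assoc', div_le_div_iff₀ h3 (by positivity)]
    nlinarith [mul_le_mul_of_nonneg_right h1 h3.le]
  calc _ = ∑' k : ℕ, ((d * (s ^ k / k !) : ℝ≥0) : ℝ≥0∞) * ‖iteratedFDeriv ℝ (k + 1) f x‖ₑ := by
        unfold taylorNorm
        rw [← ENNReal.tsum_mul_left]
        refine tsum_congr fun k => ?_
        rw [ENNReal.coe_mul, mul_assoc]
        congr 2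
        simp only [enorm_eq_nnnorm]
        congr 1
        exact NNReal.eq norm_iteratedFDeriv_fderiv
    _ ≤ ∑' k : ℕ, (((s + d) ^ (k + 1) / (k + 1)! : ℝ≥0) : ℝ≥0∞) *
          ‖iteratedFDeriv ℝ (k + 1) f x‖ₑ := by
        refine ENNReal.tsum_le_tsum fun k => ?_
        gcongr
        exact hterm k
    _ ≤ _ := ENNReal.tsum_comp_le_tsum_of_injective (add_left_injective 1)
        fun k => (((s + d) ^ k / k ! : ℝ≥0) : ℝ≥0∞) * ‖iteratedFDeriv ℝ k f x‖ₑ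

end TaylorNorm

/-! ### Finiteness of the Taylor norm and analyticity -/

section TaylorNormAnalytic

open scoped NNReal ENNReal Nat

variable {E F : Type*} [NormedAddCommGroup E] [NormedSpace ℝ E] [NormedAddCommGroup F]
  [NormedSpace ℝ F]

/-- The Taylor series of `f` at `x`, in terms of iterated derivatives. -/
noncomputable def taylorSeries (f : E → F) (x : E) : FormalMultilinearSeries ℝ E F :=
  fun k => (k ! : ℝ)⁻¹ • iteratedFDeriv ℝ k f x

theorem taylorNorm_eq_tsum_taylorSeries (s : ℝ≥0) (f : E → F) (x : E) :
    taylorNorm s f x = ∑' k, ((‖taylorSeries f x k‖₊ * s ^ k : ℝ≥0) : ℝ≥0∞) := by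
  refine tsum_congr fun k => ?_
  simp only [taylorSeries, nnnorm_smul, enorm_eq_nnnorm]
  rw [← ENNReal.coe_mul]
  congr 1
  simp
  ring

/-- An analytic function has finite Taylor norm for small radii. -/
theorem AnalyticAt.exists_taylorNorm_ne_top [CompleteSpace F] {f : E → F} {x : E}
    (h : AnalyticAt ℝ f x) : ∃ s : ℝ≥0, 0 < s ∧ taylorNorm s f x ≠ ⊤ := by
  obtain ⟨p, r, hp⟩ := h
  obtain ⟨s, hs0, hs⟩ := ENNReal.lt_iff_exists_nnreal_btwn.1 hp.radius_pos
  refine ⟨s, by exact_mod_cast hs0, ?_⟩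
  refine ne_top_of_le_ne_top
    (ENNReal.tsum_coe_ne_top_iff_summable.2 (p.summable_nnnorm_mul_pow hs)) ?_
  rw [taylorNorm_eq_tsum_taylorSeries]
  refine ENNReal.tsum_le_tsum fun k => ?_
  gcongr
  simp only [taylorSeries, nnnorm_smul]
  have hk : ‖iteratedFDeriv ℝ k f x‖ ≤ k ! * ‖p k‖ := by
    refine ContinuousMultilinearMap.opNorm_le_bound (by positivity) fun v => ?_
    rw [hp.iteratedFDeriv_eq_sum_of_completeSpace]
    refine (norm_sum_le _ _).trans ?_
    have : ∀ σ ∈ (Finset.univ : Finset (Equiv.Perm (Fin k))),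
        ‖p k (fun i => v (σ i))‖ ≤ ‖p k‖ * ∏ i, ‖v i‖ := fun σ _ => by
      refine ((p k).le_opNorm _).trans_eq ?_
      rw [Equiv.prod_comp σ fun i => ‖v i‖]
    refine (Finset.sum_le_sum this).trans_eq ?_
    simp [Fintype.card_perm]
    ring
  rw [← NNReal.coe_le_coe]
  push_cast
  have h3 : (0 : ℝ) < k ! := by exact_mod_cast Nat.factorial_pos k
  rw [norm_inv, Real.norm_of_nonneg h3.le, inv_mul_le_iff₀ h3]
  exact hk

/-- A function that is analytic on a ball is the sum of its Taylor series there, as soon as the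
corresponding Taylor norm is finite. -/
theorem AnalyticOnNhd.hasFPowerSeriesOnBall_taylorSeries [CompleteSpace F] {f : E → F} {x : E}
    {r : ℝ≥0} (hr : 0 < r) (hf : AnalyticOnNhd ℝ f (Metric.eball x r))
    (h : taylorNorm r f x ≠ ⊤) : HasFPowerSeriesOnBall f (taylorSeries f x) x r := by
  have hrad : (r : ℝ≥0∞) ≤ (taylorSeries f x).radius := by
    rw [taylorNorm_eq_tsum_taylorSeries] at h
    exact FormalMultilinearSeries.le_radius_of_summable_nnnorm _
      (ENNReal.tsum_coe_ne_top_iff_summable.1 h)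
  have hr' : (0 : ℝ≥0∞) < r := by exact_mod_cast hr
  obtain ⟨p, ρ, hp⟩ := hf x (Metric.mem_eball_self hr')
  have hsum := ((taylorSeries f x).hasFPowerSeriesOnBall (hr'.trans_le hrad)).comp_sub x
  rw [zero_add] at hsum
  replace hsum := hsum.mono hr' hrad
  have hev : f =ᶠ[𝓝 x] fun y => (taylorSeries f x).sum (y - x) := by
    filter_upwards [Metric.eball_mem_nhds x hp.r_pos] with y hy
    have hy' : y - x ∈ Metric.eball (0 : E) ρ := by
      simpa [edist_eq_enorm_sub] using hy
    have h1 := hp.hasSum_iteratedFDeriv hy'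
    rw [add_sub_cancel] at h1
    exact h1.tsum_eq.symm
  have heq := hsum.analyticOnNhd.eqOn_of_preconnected_of_eventuallyEq hf
    (by
      rw [Metric.eball_coe]
      exact (convex_ball x (r : ℝ)).isPreconnected) (Metric.mem_eball_self hr') hev.symm
  exact hsum.congr heq

theorem enorm_le_taylorNorm [CompleteSpace F] {f : E → F} {x : E} {r : ℝ≥0}
    (hf : AnalyticOnNhd ℝ f (Metric.eball x r)) {y : E} (hy : y ∈ Metric.eball x r) :
    ‖f y‖ₑ ≤ taylorNorm r f x := by
  by_cases h : taylorNorm r f x = ⊤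
  · simp [h]
  have hr : 0 < r := by
    have := zero_le.trans_lt (Metric.mem_eball.1 hy)
    exact_mod_cast this
  have hp := hf.hasFPowerSeriesOnBall_taylorSeries hr h
  have hs := (hp.hasSum_sub hy)
  have hyn : ‖y - x‖₊ ≤ r := by
    rw [Metric.mem_eball, edist_eq_enorm_sub] at hy
    exact_mod_cast hy.le
  rw [taylorNorm_eq_tsum_taylorSeries] at h ⊢
  have hsm := ENNReal.tsum_coe_ne_top_iff_summable.1 h
  rw [← ENNReal.coe_tsum hsm, ← hs.tsum_eq]
  have hb : ∀ k, ‖taylorSeries f x k fun _ => y - x‖₊ ≤ ‖taylorSeries f x k‖₊ * r ^ k := fun k => by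
    refine ((taylorSeries f x k).le_opNNNorm _).trans ?_
    simp only [Finset.prod_const, Finset.card_univ, Fintype.card_fin]
    gcongr
  rw [enorm_eq_nnnorm]
  exact_mod_cast tsum_of_nnnorm_bounded hsm.hasSum hb

/-- A series of analytic functions with summable Taylor norms at the centre of a ball has an
analytic sum on that ball. -/
theorem analyticOnNhd_tsum_of_taylorNorm [CompleteSpace F] {f : ℕ → E → F} {x : E} {r : ℝ≥0}
    (hr : 0 < r) (hf : ∀ n, AnalyticOnNhd ℝ (f n) (Metric.eball x r))
    (h : ∑' n, taylorNorm r (f n) x ≠ ⊤) :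
    AnalyticOnNhd ℝ (fun y => ∑' n, f n y) (Metric.eball x r) := by
  have hr' : (0 : ℝ≥0∞) < r := by exact_mod_cast hr
  have hn : ∀ n, taylorNorm r (f n) x ≠ ⊤ := fun n => ne_top_of_le_ne_top h (ENNReal.le_tsum n)
  have hp := fun n => (hf n).hasFPowerSeriesOnBall_taylorSeries hr (hn n)
  set a : ℕ → ℕ → ℝ≥0 := fun n k => ‖taylorSeries (f n) x k‖₊ * r ^ k with ha
  have hsum : Summable fun q : ℕ × ℕ => a q.1 q.2 := by
    rw [← ENNReal.tsum_coe_ne_top_iff_summable,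
      ENNReal.tsum_prod (f := fun n k => (a n k : ℝ≥0∞))]
    simpa only [taylorNorm_eq_tsum_taylorSeries] using h
  have hcomm : ∑' k, ∑' n, (a n k : ℝ≥0∞) ≠ ⊤ := by
    rw [ENNReal.tsum_comm]
    simpa only [taylorNorm_eq_tsum_taylorSeries] using h
  have hsumk : ∀ k, Summable fun n => a n k := fun k =>
    ENNReal.tsum_coe_ne_top_iff_summable.1 (ne_top_of_le_ne_top hcomm (ENNReal.le_tsum k))
  have hcoef : ∀ k, Summable fun n => ‖taylorSeries (f n) x k‖₊ := fun k => by
    have := (hsumk k).mul_right ((r ^ k)⁻¹)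
    refine this.congr fun n => ?_
    simp only [ha]
    rw [mul_assoc, mul_inv_cancel₀ (pow_ne_zero _ hr.ne'), mul_one]
  have hcoef' : ∀ k, Summable fun n => taylorSeries (f n) x k := fun k =>
    Summable.of_nnnorm (hcoef k)
  set P : FormalMultilinearSeries ℝ E F := fun k => ∑' n, taylorSeries (f n) x k with hP
  have hPball : HasFPowerSeriesOnBall (fun y => ∑' n, f n y) P x r := by
    refine ⟨?_, hr', fun {y} hy => ?_⟩
    · refine FormalMultilinearSeries.le_radius_of_summable_nnnorm _ ?_
      have h1 : Summable fun k => ∑' n, a n k := by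
        rw [← ENNReal.tsum_coe_ne_top_iff_summable]
        refine ne_of_eq_of_ne (tsum_congr fun k => ?_) hcomm
        exact ENNReal.coe_tsum (hsumk k)
      refine NNReal.summable_of_le (fun k => ?_) h1
      simp only [ha]
      rw [NNReal.tsum_mul_right]
      gcongr
      exact nnnorm_tsum_le (hcoef k)
    · have hyn : ‖y‖₊ ≤ r := by
        rw [Metric.mem_eball, edist_zero_right] at hy
        exact_mod_cast hy.le
      have hy' : ∀ n, HasSum (fun k => taylorSeries (f n) x k fun _ => y) (f n (x + y)) :=
        fun n => (hp n).hasSum hy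
      have hb : ∀ n k, ‖taylorSeries (f n) x k fun _ => y‖₊ ≤ a n k := fun n k => by
        refine ((taylorSeries (f n) x k).le_opNNNorm _).trans ?_
        simp only [Finset.prod_const, Finset.card_univ, Fintype.card_fin, ha]
        gcongr
      have hS : Summable fun q : ℕ × ℕ => taylorSeries (f q.1) x q.2 fun _ => y :=
        Summable.of_nnnorm (NNReal.summable_of_le (fun q => hb q.1 q.2) hsum)
      have h1 := hS.hasSum.prod_fiberwise hy'
      have h2 := (hS.prod_symm).hasSum.prod_fiberwise
        (g := fun k => P k fun _ => y) fun k => by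
          have := (ContinuousMultilinearMap.apply ℝ (fun _ : Fin k => E) F
            (fun _ => y)).hasSum (hcoef' k).hasSum
          exact this
      have h3 := (Equiv.prodComm ℕ ℕ).tsum_eq
        fun q : ℕ × ℕ => taylorSeries (f q.1) x q.2 fun _ => y
      rw [h1.tsum_eq, ← h3]
      exact h2
  exact hPball.analyticOnNhd

end TaylorNormAnalytic

/-! ### Cauchy products and the cubic recursion -/

section CauchyProduct

open scoped NNReal ENNReal
open Finset.HasAntidiagonal (antidiagonal)

variable {F G H : Type*} [NormedAddCommGroup F]
  [NormedSpace ℝ F] [NormedAddCommGroup G] [NormedSpace ℝ G] [NormedAddCommGroup H]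
  [NormedSpace ℝ H]

theorem summable_norm_sum_antidiagonal_bilinear (B : F →L[ℝ] G →L[ℝ] H) {f : ℕ → F} {g : ℕ → G}
    (hf : Summable fun n => ‖f n‖) (hg : Summable fun n => ‖g n‖) :
    Summable fun n => ‖∑ p ∈ antidiagonal n, B (f p.1) (g p.2)‖ := by
  have h := (summable_norm_sum_mul_antidiagonal_of_summable_norm
    (f := fun n => ‖f n‖) (g := fun n => ‖g n‖) (by simpa using hf)
    (by simpa using hg)).mul_left ‖B‖
  refine Summable.of_nonneg_of_le (fun _ => norm_nonneg _) (fun n => ?_) h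
  rw [Real.norm_of_nonneg (by positivity), Finset.mul_sum]
  refine (norm_sum_le _ _).trans (Finset.sum_le_sum fun p _ => ?_)
  simpa [mul_assoc] using B.le_opNorm₂ (f p.1) (g p.2)

theorem tsum_sum_antidiagonal_bilinear [CompleteSpace F] [CompleteSpace G] [CompleteSpace H]
    (B : F →L[ℝ] G →L[ℝ] H) {f : ℕ → F} {g : ℕ → G}
    (hf : Summable fun n => ‖f n‖) (hg : Summable fun n => ‖g n‖) :
    ∑' n, ∑ p ∈ antidiagonal n, B (f p.1) (g p.2) = B (∑' n, f n) (∑' n, g n) := by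
  have hfg : Summable fun p : ℕ × ℕ => B (f p.1) (g p.2) := by
    refine Summable.of_norm_bounded ((hf.mul_of_nonneg hg (fun _ => norm_nonneg _)
      fun _ => norm_nonneg _).mul_left ‖B‖) fun p => ?_
    simpa [mul_assoc] using B.le_opNorm₂ (f p.1) (g p.2)
  conv_lhs => congr; ext; rw [← Finset.sum_finset_coe, ← tsum_fintype (L := .unconditional _)]
  have h1 := Finset.HasAntidiagonal.sigmaAntidiagonalEquivProd.tsum_eq
    (fun p : ℕ × ℕ => B (f p.1) (g p.2))
  have h2 := (Finset.HasAntidiagonal.sigmaAntidiagonalEquivProd.summable_iff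
    (f := fun p : ℕ × ℕ => B (f p.1) (g p.2))).2 hfg
  have h3 := h2.tsum_sigma' (fun n => (hasSum_fintype _).summable)
  refine Eq.trans h3.symm (h1.trans ?_)
  rw [hfg.tsum_prod' fun n => (B (f n)).summable hg.of_norm]
  have h4 : ∀ n, ∑' m, B (f n) (g m) = B.flip (∑' m, g m) (f n) := fun n => by
    rw [ContinuousLinearMap.flip_apply, (B (f n)).map_tsum hg.of_norm]
  simp_rw [h4]
  rw [← (B.flip (∑' m, g m)).map_tsum hf.of_norm, ContinuousLinearMap.flip_apply]

theorem sum_range_sum_antidiagonal_le (f g : ℕ → ℝ≥0) (N : ℕ) :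
    ∑ n ∈ Finset.range N, ∑ p ∈ antidiagonal n, f p.1 * g p.2 ≤
      (∑ n ∈ Finset.range N, f n) * ∑ n ∈ Finset.range N, g n := by
  rw [Finset.sum_mul_sum, ← Finset.sum_product', Finset.sum_sigma']
  have hinj : Set.InjOn (fun x : Σ _ : ℕ, ℕ × ℕ => x.2)
      ((Finset.range N).sigma fun n => antidiagonal n : Finset (Σ _ : ℕ, ℕ × ℕ)) := by
    rintro ⟨n, p⟩ hn ⟨m, q⟩ hm (rfl : p = q)
    simp only [Finset.coe_sigma, Set.mem_sigma_iff, Finset.mem_coe,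
      Finset.HasAntidiagonal.mem_antidiagonal] at hn hm
    rw [← hn.2, ← hm.2]
  rw [← Finset.sum_image (f := fun p : ℕ × ℕ => f p.1 * g p.2) hinj]
  refine Finset.sum_le_sum_of_subset fun p hp => ?_
  simp only [Finset.mem_image, Finset.mem_sigma, Finset.mem_range,
    Finset.HasAntidiagonal.mem_antidiagonal] at hp
  obtain ⟨⟨n, q⟩, ⟨hn, hq⟩, rfl⟩ := hp
  simp only at hn hq
  simp only [Finset.mem_product, Finset.mem_range]
  omega

/-- Existence of a sequence satisfying a recursion in which each term depends on all the previous
ones. -/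
theorem exists_seq_of_strong_recursion {X : Type*} (a : X) (Γ : ℕ → (ℕ → X) → X)
    (hΓ : ∀ n (u v : ℕ → X), (∀ i ≤ n, u i = v i) → Γ n u = Γ n v) :
    ∃ u : ℕ → X, u 0 = a ∧ ∀ n, u (n + 1) = Γ n u := by
  let S : ℕ → ℕ → X := fun N => Nat.rec (fun _ => a)
    (fun n s m => if m ≤ n then s m else Γ n s) N
  have hS : ∀ n m, S (n + 1) m = if m ≤ n then S n m else Γ n (S n) := fun _ _ => rfl
  have hst : ∀ k m, S (m + k) m = S m m := by
    intro k m
    induction k with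
    | zero => rfl
    | succ k ih => rw [← add_assoc, hS, if_pos (by omega), ih]
  refine ⟨fun n => S n n, rfl, fun n => ?_⟩
  simp only [hS, if_neg (show ¬ n + 1 ≤ n by omega)]
  refine hΓ n _ _ fun i hi => ?_
  obtain ⟨k, rfl⟩ := Nat.exists_eq_add_of_le hi
  exact hst k i

/-- The cubic recursion `Mₙ₊₁ = A ∑ Mᵢ Mⱼ Mₖ` over `i + j + k = n` grows at most geometrically. -/
theorem exists_summable_of_cubic_recursion {A : ℝ≥0} {M : ℕ → ℝ≥0}
    (hM : ∀ n, M (n + 1) = A * ∑ p ∈ antidiagonal n,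
      (∑ q ∈ antidiagonal p.1, M q.1 * M q.2) * M p.2) :
    ∃ τ : ℝ≥0, 0 < τ ∧ Summable fun n => M n * τ ^ n := by
  -- `τ` is small enough that the bound `∑ Mₙ τⁿ ≤ 2 m` passes from `N` to `N + 1` terms.
  set m := M 0 + 1 with hm
  set τ : ℝ≥0 := (8 * A * m ^ 3 + 1)⁻¹ with hτ
  have hτ0 : 0 < τ := by positivity
  have hτA : A * τ * (2 * m) ^ 3 ≤ 1 := by
    rw [hτ]
    have : (8 * A * m ^ 3 + 1 : ℝ≥0) ≠ 0 := by positivity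
    rw [mul_right_comm, ← div_eq_mul_inv, div_le_one (by positivity)]
    refine le_trans (le_of_eq ?_) le_self_add
    ring
  refine ⟨τ, hτ0, ?_⟩
  have key : ∀ N, ∑ n ∈ Finset.range N, M n * τ ^ n ≤ 2 * m := by
    intro N
    induction N with
    | zero => simp
    | succ N ih =>
      rw [Finset.sum_range_succ']
      have h1 : ∑ n ∈ Finset.range N, M (n + 1) * τ ^ (n + 1) = A * τ *
          ∑ n ∈ Finset.range N, ∑ p ∈ antidiagonal n, (∑ q ∈ antidiagonal p.1,
            (M q.1 * τ ^ q.1) * (M q.2 * τ ^ q.2)) * (M p.2 * τ ^ p.2) := by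
        rw [Finset.mul_sum]
        refine Finset.sum_congr rfl fun n _ => ?_
        have hl : ∀ l, ∑ q ∈ antidiagonal l, (M q.1 * τ ^ q.1) * (M q.2 * τ ^ q.2) =
            (∑ q ∈ antidiagonal l, M q.1 * M q.2) * τ ^ l := fun l => by
          rw [Finset.sum_mul]
          refine Finset.sum_congr rfl fun q hq => ?_
          rw [← Finset.HasAntidiagonal.mem_antidiagonal.1 hq]
          ring
        rw [hM, Finset.mul_sum, Finset.mul_sum, Finset.sum_mul]
        refine Finset.sum_congr rfl fun p hp => ?_
        rw [hl, ← Finset.HasAntidiagonal.mem_antidiagonal.1 hp]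
        ring
      have h2 : ∑ n ∈ Finset.range N, ∑ p ∈ antidiagonal n, (∑ q ∈ antidiagonal p.1,
            (M q.1 * τ ^ q.1) * (M q.2 * τ ^ q.2)) * (M p.2 * τ ^ p.2) ≤ (2 * m) ^ 3 := by
        calc _ ≤ _ := sum_range_sum_antidiagonal_le (fun n => ∑ q ∈ antidiagonal n,
              (M q.1 * τ ^ q.1) * (M q.2 * τ ^ q.2)) (fun n => M n * τ ^ n) N
          _ ≤ ((2 * m) * (2 * m)) * (2 * m) := by
            gcongr
            refine (sum_range_sum_antidiagonal_le (fun n => M n * τ ^ n)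
              (fun n => M n * τ ^ n) N).trans ?_
            gcongr
          _ = _ := by ring
      rw [h1]
      calc _ ≤ A * τ * (2 * m) ^ 3 + M 0 := by
            gcongr
            simp
        _ ≤ 1 + M 0 := by gcongr
        _ ≤ 2 * m := by rw [add_comm, ← hm, two_mul]; exact le_self_add
  exact NNReal.summable_of_sum_range_le key

end CauchyProduct

section TimeSeries

open scoped NNReal ENNReal Nat

variable {E F : Type*} [NormedAddCommGroup E] [NormedSpace ℝ E] [NormedAddCommGroup F]
  [NormedSpace ℝ F]

theorem taylorNorm_comp_snd_le [CompleteSpace F] {s : ℝ≥0} {u : E → F} {z : ℝ × E}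
    (hu : AnalyticAt ℝ u z.2) :
    taylorNorm s (fun y : ℝ × E => u y.2) z ≤ taylorNorm s u z.2 := by
  refine taylorNorm_le_of_iteratedFDeriv_le fun k => ?_
  obtain ⟨v, hv, huv⟩ := ((hu.contDiffAt (n := ω)).eventually (by simp)).exists_mem
  obtain ⟨w, hwv, hw, hzw⟩ := mem_nhds_iff.1 hv
  have hw' : IsOpen (ContinuousLinearMap.snd ℝ ℝ E ⁻¹' w) := hw.preimage (by fun_prop)
  have h := (ContinuousLinearMap.snd ℝ ℝ E).iteratedFDerivWithin_comp_right (n := ω) (f := u)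
    (s := w) (fun y hy => (huv y (hwv hy)).contDiffWithinAt) hw.uniqueDiffOn hw'.uniqueDiffOn
    (x := z) hzw (i := k) (by simp)
  rw [iteratedFDerivWithin_of_isOpen _ hw' hzw, ContinuousLinearMap.coe_snd',
    iteratedFDerivWithin_of_isOpen _ hw hzw] at h
  change ‖iteratedFDeriv ℝ k (u ∘ Prod.snd) z‖ ≤ _
  rw [h]
  refine (ContinuousMultilinearMap.norm_compContinuousLinearMap_le _ _).trans ?_
  refine mul_le_of_le_one_right (norm_nonneg _) (Finset.prod_le_one (fun _ _ => norm_nonneg _)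
    fun _ _ => ContinuousLinearMap.norm_snd_le ℝ ℝ E)

theorem taylorNorm_fst_le (s : ℝ≥0) (x : E) :
    taylorNorm s (fun y : ℝ × E => y.1) (0, x) ≤ s := by
  unfold taylorNorm
  have h : ∀ k, k ≠ 1 → ((s ^ k / k ! : ℝ≥0) : ℝ≥0∞) *
      ‖iteratedFDeriv ℝ k (fun y : ℝ × E => y.1) (0, x)‖ₑ = 0 := by
    intro k hk
    have : ‖iteratedFDeriv ℝ k (fun y : ℝ × E => y.1) (0, x)‖ = 0 := by
      rcases k with _ | _ | k
      · simp
      · exact absurd rfl hk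
      · rw [← norm_iteratedFDeriv_fderiv]
        have : fderiv ℝ (fun y : ℝ × E => y.1) = fun _ => ContinuousLinearMap.fst ℝ ℝ E := by
          funext y
          exact fderiv_fst
        rw [this, iteratedFDeriv_succ_const]
        simp
    rw [← ofReal_norm, this]
    simp
  rw [tsum_eq_single 1 h]
  have h1 : ‖iteratedFDeriv ℝ 1 (fun y : ℝ × E => y.1) (0, x)‖ ≤ 1 := by
    rw [norm_iteratedFDeriv_one, fderiv_fst]
    exact ContinuousLinearMap.norm_fst_le ℝ ℝ E
  have h2 : ‖iteratedFDeriv ℝ 1 (fun y : ℝ × E => y.1) (0, x)‖ₑ ≤ 1 := by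
    rw [← ofReal_norm]
    exact ENNReal.ofReal_le_one.2 h1
  calc _ ≤ ((s ^ 1 / 1 ! : ℝ≥0) : ℝ≥0∞) * 1 := by gcongr
    _ = s := by simp

theorem taylorNorm_pow_smul_le [CompleteSpace F] {s : ℝ≥0} {u : E → F} {x : E}
    (hu : AnalyticAt ℝ u x) (n : ℕ) :
    taylorNorm s (fun y : ℝ × E => y.1 ^ n • u y.2) (0, x) ≤ s ^ n * taylorNorm s u x := by
  induction n with
  | zero => simpa using taylorNorm_comp_snd_le (z := (0, x)) hu
  | succ n ih =>
    have hu' : AnalyticAt ℝ (fun y : ℝ × E => u y.2) (0, x) :=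
      AnalyticAt.fun_comp (f := fun y : ℝ × E => y.2) hu analyticAt_snd
    have h1 : AnalyticAt ℝ (fun y : ℝ × E => y.1 ^ n • u y.2) (0, x) :=
      (analyticAt_fst.pow n).smul hu'
    have h := taylorNorm_bilinear_le (ContinuousLinearMap.lsmul ℝ ℝ) (s := s)
      (analyticAt_fst (𝕜 := ℝ) (E := ℝ) (F := E) (p := (0, x))) h1
    have h2 : (fun y : ℝ × E => ContinuousLinearMap.lsmul ℝ ℝ y.1 (y.1 ^ n • u y.2)) =
        fun y => y.1 ^ (n + 1) • u y.2 := by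
      funext y
      simp [smul_smul, pow_succ, mul_comm]
    rw [h2] at h
    have h3 : ‖(ContinuousLinearMap.lsmul ℝ ℝ : ℝ →L[ℝ] F →L[ℝ] F)‖ₑ ≤ 1 := by
      rw [← ofReal_norm]
      exact ENNReal.ofReal_le_one.2 ContinuousLinearMap.opNorm_lsmul_le
    calc _ ≤ _ := h
      _ ≤ 1 * (s * (s ^ n * taylorNorm s u x)) := by
        gcongr
        exact taylorNorm_fst_le s x
      _ = _ := by ring

end TimeSeries

/-! ### Estimates for the coefficients of the power series in time -/

section CauchyKovalevskaya

set_option maxSynthPendingDepth 3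

open scoped NNReal ENNReal Nat
open Finset.HasAntidiagonal (antidiagonal)

variable {E F G W Y : Type*} [NormedAddCommGroup E] [NormedSpace ℝ E] [NormedAddCommGroup F]
  [NormedSpace ℝ F] [NormedAddCommGroup G] [NormedSpace ℝ G] [NormedAddCommGroup W]
  [NormedSpace ℝ W] [NormedAddCommGroup Y] [NormedSpace ℝ Y]

/-- The coefficient of `tⁿ` in `S(T(Du, Du), Du)`, for `u = ∑ tⁿ uₙ`. -/
noncomputable def cubicCoeff (T : (E →L[ℝ] F) →L[ℝ] (E →L[ℝ] F) →L[ℝ] Y)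
    (S : Y →L[ℝ] (E →L[ℝ] F) →L[ℝ] G) (u : ℕ → E → F) (n : ℕ) (x : E) : G :=
  ∑ p ∈ antidiagonal n, S (∑ q ∈ antidiagonal p.1,
    T (fderiv ℝ (u q.1) x) (fderiv ℝ (u q.2) x)) (fderiv ℝ (u p.2) x)

theorem analyticAt_bilinear (B : F →L[ℝ] W →L[ℝ] G) {f : E → F} {g : E → W} {x : E}
    (hf : AnalyticAt ℝ f x) (hg : AnalyticAt ℝ g x) : AnalyticAt ℝ (fun y => B (f y) (g y)) x :=
  (B.analyticAt_bilinear (f x, g x)).comp₂ hf hg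

variable {T : (E →L[ℝ] F) →L[ℝ] (E →L[ℝ] F) →L[ℝ] Y} {S : Y →L[ℝ] (E →L[ℝ] F) →L[ℝ] G}
  {u : ℕ → E → F} {x : E}

theorem analyticAt_cubicCoeff [CompleteSpace F] {n : ℕ} (hu : ∀ i ≤ n, AnalyticAt ℝ (u i) x) :
    AnalyticAt ℝ (cubicCoeff T S u n) x := by
  unfold cubicCoeff
  refine Finset.analyticAt_fun_sum _ fun p hp => ?_
  have hp' := Finset.HasAntidiagonal.mem_antidiagonal.1 hp
  refine analyticAt_bilinear S (Finset.analyticAt_fun_sum _ fun q hq => ?_)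
    (hu p.2 (by omega)).fderiv
  have hq' := Finset.HasAntidiagonal.mem_antidiagonal.1 hq
  exact analyticAt_bilinear T (hu q.1 (by omega)).fderiv (hu q.2 (by omega)).fderiv

theorem taylorNorm_cubicCoeff_le [CompleteSpace F] [CompleteSpace Y] [CompleteSpace G] {n : ℕ}
    {s : ℝ≥0} (hu : ∀ i ≤ n, AnalyticAt ℝ (u i) x) :
    taylorNorm s (cubicCoeff T S u n) x ≤ (‖S‖ₑ * ‖T‖ₑ) * ∑ p ∈ antidiagonal n,
      (∑ q ∈ antidiagonal p.1, taylorNorm s (fderiv ℝ (u q.1)) x *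
        taylorNorm s (fderiv ℝ (u q.2)) x) * taylorNorm s (fderiv ℝ (u p.2)) x := by
  have hd : ∀ i ≤ n, AnalyticAt ℝ (fderiv ℝ (u i)) x := fun i hi => (hu i hi).fderiv
  have hq : ∀ p ∈ antidiagonal n, ∀ q ∈ antidiagonal p.1, AnalyticAt ℝ
      (fun y => T (fderiv ℝ (u q.1) y) (fderiv ℝ (u q.2) y)) x := fun p hp q hq => by
    have hp' := Finset.HasAntidiagonal.mem_antidiagonal.1 hp
    have hq' := Finset.HasAntidiagonal.mem_antidiagonal.1 hq
    exact analyticAt_bilinear T (hd q.1 (by omega)) (hd q.2 (by omega))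
  have hp : ∀ p ∈ antidiagonal n, AnalyticAt ℝ (fun y => ∑ q ∈ antidiagonal p.1,
      T (fderiv ℝ (u q.1) y) (fderiv ℝ (u q.2) y)) x := fun p hp =>
    Finset.analyticAt_fun_sum _ fun q hq' => hq p hp q hq'
  have hd' : ∀ p ∈ antidiagonal n, AnalyticAt ℝ (fderiv ℝ (u p.2)) x := fun p hp => by
    have hp' := Finset.HasAntidiagonal.mem_antidiagonal.1 hp
    exact hd p.2 (by omega)
  unfold cubicCoeff
  refine (taylorNorm_sum_le fun p hp' => analyticAt_bilinear S (hp p hp') (hd' p hp')).trans ?_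
  rw [Finset.mul_sum]
  refine Finset.sum_le_sum fun p hp' => ?_
  refine (taylorNorm_bilinear_le S (hp p hp') (hd' p hp')).trans ?_
  rw [mul_assoc, ← mul_assoc ‖T‖ₑ, Finset.mul_sum]
  gcongr
  refine (taylorNorm_sum_le fun q hq' => hq p hp' q hq').trans (Finset.sum_le_sum fun q hq' => ?_)
  have hp'' := Finset.HasAntidiagonal.mem_antidiagonal.1 hp'
  have hq'' := Finset.HasAntidiagonal.mem_antidiagonal.1 hq'
  exact taylorNorm_bilinear_le T (hd q.1 (by omega)) (hd q.2 (by omega))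

/-- The product of the factor `1 / (n + 1)` of the recursion, the factor `n + 2` of Cauchy's
estimate and the factor `(1 + 1 / (n + 1)) ^ n` lost by shrinking the radius is bounded: the last
factor is at most `e`. -/
theorem recursion_constant_le (n : ℕ) :
    ((n + 1 : ℝ≥0)⁻¹ * (n + 2)) * ((n + 2) / (n + 1)) ^ n ≤ 6 := by
  rw [← NNReal.coe_le_coe]
  push_cast
  have hn : (0 : ℝ) < n + 1 := by positivity
  have h1 : ((n : ℝ) + 1)⁻¹ * (n + 2) ≤ 2 := by
    rw [inv_mul_le_iff₀ hn]
    linarith [(Nat.cast_nonneg n : (0 : ℝ) ≤ n)]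
  have h2 : (((n : ℝ) + 2) / (n + 1)) ^ n ≤ 3 := by
    have h3 : ((n : ℝ) + 2) / (n + 1) ≤ Real.exp (1 / (n + 1)) := by
      refine le_trans (le_of_eq ?_) (Real.add_one_le_exp _)
      field_simp
      ring
    calc _ ≤ (Real.exp (1 / ((n : ℝ) + 1))) ^ n := by gcongr
      _ = Real.exp (n * (1 / ((n : ℝ) + 1))) := by rw [← Real.exp_nat_mul]
      _ ≤ Real.exp 1 := by
        gcongr
        rw [mul_one_div, div_le_one hn]
        linarith
      _ ≤ 3 := (Real.exp_one_lt_d9.trans (by norm_num)).le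
  calc _ ≤ (2 : ℝ) * 3 := by gcongr
    _ = 6 := by norm_num

/-- The estimates for the coefficients of the Cauchy–Kovalevskaya solution: with `s + d = R`, the
`n`-th coefficient loses a factor `d⁻ⁿ` on the radius `s`. -/
theorem taylorNorm_coeff_le [CompleteSpace F] [CompleteSpace Y] {S : Y →L[ℝ] (E →L[ℝ] F) →L[ℝ] F}
    {c : E → ℝ} {R C : ℝ≥0} {M : ℕ → ℝ≥0}
    (hu : ∀ n, AnalyticAt ℝ (u n) x) (hc : AnalyticAt ℝ c x) (hcC : taylorNorm R c x ≤ C)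
    (hrec : ∀ n, u (n + 1) =ᶠ[𝓝 x] fun y => (n + 1 : ℝ)⁻¹ • c y • cubicCoeff T S u n y)
    (hM0 : taylorNorm R (fderiv ℝ (u 0)) x ≤ M 0)
    (hM : ∀ n, M (n + 1) = (6 * C * (‖S‖₊ * ‖T‖₊)) *
      ∑ p ∈ antidiagonal n, (∑ q ∈ antidiagonal p.1, M q.1 * M q.2) * M p.2) (n : ℕ) :
    (∀ s d, s + d = R → taylorNorm s (fderiv ℝ (u n)) x * d ^ n ≤ M n) ∧
    ∀ s d, s + d = R → taylorNorm s (u (n + 1)) x * d ^ n ≤ M (n + 1) := by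
  have step : ∀ n, (∀ i ≤ n, ∀ s d, s + d = R → taylorNorm s (fderiv ℝ (u i)) x * d ^ i ≤ M i) →
      ∀ s d, s + d = R → taylorNorm s (u (n + 1)) x * d ^ n ≤
        ((n + 1 : ℝ≥0)⁻¹ * (C * (‖S‖₊ * ‖T‖₊) * ∑ p ∈ antidiagonal n,
          (∑ q ∈ antidiagonal p.1, M q.1 * M q.2) * M p.2) : ℝ≥0) := by
    intro n ih s d hsd
    have hsR : s ≤ R := by rw [← hsd]; exact le_self_add
    have hcub := analyticAt_cubicCoeff (T := T) (S := S) fun i (_ : i ≤ n) => hu i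
    have h1 : taylorNorm s (u (n + 1)) x ≤ ((n + 1 : ℝ≥0)⁻¹ : ℝ≥0) * (C *
        taylorNorm s (cubicCoeff T S u n) x) := by
      rw [taylorNorm_congr (hrec n),
        taylorNorm_const_smul (f := fun y => c y • cubicCoeff T S u n y) _ (hc.smul hcub)]
      have h2 := taylorNorm_bilinear_le (ContinuousLinearMap.lsmul ℝ ℝ) (s := s) hc hcub
      have h3 : ‖(ContinuousLinearMap.lsmul ℝ ℝ : ℝ →L[ℝ] F →L[ℝ] F)‖ₑ ≤ 1 := by
        rw [← ofReal_norm]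
        exact ENNReal.ofReal_le_one.2 ContinuousLinearMap.opNorm_lsmul_le
      have h4 : ‖((n : ℝ) + 1)⁻¹‖ₑ = (((n + 1 : ℝ≥0)⁻¹ : ℝ≥0) : ℝ≥0∞) := by
        rw [enorm_eq_nnnorm]
        congr 1
        apply NNReal.eq
        rw [coe_nnnorm, Real.norm_of_nonneg (by positivity)]
        push_cast
        rfl
      rw [h4]
      gcongr
      calc _ ≤ _ := h2
        _ ≤ 1 * (C * taylorNorm s (cubicCoeff T S u n) x) := by
          gcongr
          exact (taylorNorm_mono hsR c x).trans hcC
        _ = _ := one_mul _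
    push_cast
    calc _ ≤ (((n + 1 : ℝ≥0)⁻¹ : ℝ≥0) * (C * ((‖S‖ₑ * ‖T‖ₑ) * ∑ p ∈ antidiagonal n,
          (∑ q ∈ antidiagonal p.1, taylorNorm s (fderiv ℝ (u q.1)) x *
            taylorNorm s (fderiv ℝ (u q.2)) x) * taylorNorm s (fderiv ℝ (u p.2)) x))) *
              (d : ℝ≥0∞) ^ n := by
          gcongr
          refine h1.trans ?_
          gcongr
          exact taylorNorm_cubicCoeff_le fun i _ => hu i
      _ = ((n + 1 : ℝ≥0)⁻¹ : ℝ≥0) * (C * (‖S‖₊ * ‖T‖₊) * ∑ p ∈ antidiagonal n,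
          (∑ q ∈ antidiagonal p.1, (taylorNorm s (fderiv ℝ (u q.1)) x * (d : ℝ≥0∞) ^ q.1) *
            (taylorNorm s (fderiv ℝ (u q.2)) x * (d : ℝ≥0∞) ^ q.2)) *
            (taylorNorm s (fderiv ℝ (u p.2)) x * (d : ℝ≥0∞) ^ p.2)) := by
          have hl : ∀ l, ∑ q ∈ antidiagonal l, (taylorNorm s (fderiv ℝ (u q.1)) x *
              (d : ℝ≥0∞) ^ q.1) * (taylorNorm s (fderiv ℝ (u q.2)) x * (d : ℝ≥0∞) ^ q.2) =
              (∑ q ∈ antidiagonal l, taylorNorm s (fderiv ℝ (u q.1)) x *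
                taylorNorm s (fderiv ℝ (u q.2)) x) * (d : ℝ≥0∞) ^ l := fun l => by
            rw [Finset.sum_mul]
            refine Finset.sum_congr rfl fun q hq => ?_
            rw [← Finset.HasAntidiagonal.mem_antidiagonal.1 hq]
            ring
          have hp : ∑ p ∈ antidiagonal n, (∑ q ∈ antidiagonal p.1,
              (taylorNorm s (fderiv ℝ (u q.1)) x * (d : ℝ≥0∞) ^ q.1) *
              (taylorNorm s (fderiv ℝ (u q.2)) x * (d : ℝ≥0∞) ^ q.2)) *
              (taylorNorm s (fderiv ℝ (u p.2)) x * (d : ℝ≥0∞) ^ p.2) =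
              (∑ p ∈ antidiagonal n, (∑ q ∈ antidiagonal p.1,
                taylorNorm s (fderiv ℝ (u q.1)) x * taylorNorm s (fderiv ℝ (u q.2)) x) *
                taylorNorm s (fderiv ℝ (u p.2)) x) * (d : ℝ≥0∞) ^ n := by
            rw [Finset.sum_mul]
            refine Finset.sum_congr rfl fun p hp => ?_
            rw [hl, ← Finset.HasAntidiagonal.mem_antidiagonal.1 hp]
            ring
          rw [hp, enorm_eq_nnnorm, enorm_eq_nnnorm]
          ring
      _ ≤ _ := by
          have hb : ∀ p ∈ antidiagonal n, ∀ i, i = p.1 ∨ i = p.2 → ∀ q ∈ antidiagonal i,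
              ∀ j, j = q.1 ∨ j = q.2 ∨ j = i →
              taylorNorm s (fderiv ℝ (u j)) x * (d : ℝ≥0∞) ^ j ≤ M j := by
            intro p hp i hi q hq j hj
            have hp' := Finset.HasAntidiagonal.mem_antidiagonal.1 hp
            have hq' := Finset.HasAntidiagonal.mem_antidiagonal.1 hq
            exact ih j (by omega) s d hsd
          refine mul_le_mul' le_rfl (mul_le_mul' le_rfl ?_)
          refine Finset.sum_le_sum fun p hp => ?_
          refine mul_le_mul' (Finset.sum_le_sum fun q hq => ?_)
            (hb p hp p.2 (.inr rfl) (p.2, 0) (by simp) p.2 (by simp))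
          exact mul_le_mul' (hb p hp p.1 (.inl rfl) q hq q.1 (by simp))
            (hb p hp p.1 (.inl rfl) q hq q.2 (by simp))
  have main : ∀ n, ∀ s d, s + d = R → taylorNorm s (fderiv ℝ (u n)) x * d ^ n ≤ M n := by
    intro n
    induction n using Nat.strong_induction_on with
    | _ n ih =>
    rcases n with _ | n
    · intro s d hsd
      have hsR : s ≤ R := by rw [← hsd]; exact le_self_add
      simpa using (taylorNorm_mono hsR _ x).trans hM0
    · intro s d hsd
      set σ : ℝ≥0 := C * (‖S‖₊ * ‖T‖₊) * ∑ p ∈ antidiagonal n,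
          (∑ q ∈ antidiagonal p.1, M q.1 * M q.2) * M p.2 with hσ
      -- Cauchy's estimate is applied between the radii `s` and `s + d / (n + 2)`.
      have h1 := step n (fun i hi => ih i (by omega)) (s + d / (n + 2)) (d * ((n + 1) / (n + 2)))
        (by
          rw [← hsd, add_assoc]
          congr 1
          field_simp
          ring)
      have h2 := taylorNorm_fderiv_le (le_self_add : s ≤ s + d / (n + 2)) (u (n + 1)) x
      rw [add_tsub_cancel_left] at h2
      calc taylorNorm s (fderiv ℝ (u (n + 1))) x * d ^ (n + 1)
          = (((d / (n + 2) : ℝ≥0) * taylorNorm s (fderiv ℝ (u (n + 1))) x) *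
            ((d * ((n + 1) / (n + 2)) : ℝ≥0) : ℝ≥0∞) ^ n) *
              (((n + 2) * ((n + 2) / (n + 1)) ^ n : ℝ≥0) : ℝ≥0∞) := by
            have : d ^ (n + 1) = (d / (n + 2)) * (d * ((n + 1) / (n + 2))) ^ n *
                ((n + 2) * ((n + 2) / (n + 1)) ^ n) := by
              rw [mul_pow, div_pow, div_pow]
              field_simp
              rw [pow_succ']
            rw [← ENNReal.coe_pow, this]
            push_cast
            ring
        _ ≤ ((n + 1 : ℝ≥0)⁻¹ * σ : ℝ≥0) * (((n + 2) * ((n + 2) / (n + 1)) ^ n : ℝ≥0) : ℝ≥0∞) := by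
            gcongr
            exact le_trans (by gcongr) h1
        _ = ((((n + 1 : ℝ≥0)⁻¹ * (n + 2)) * ((n + 2) / (n + 1)) ^ n * σ : ℝ≥0) : ℝ≥0∞) := by
            rw [← ENNReal.coe_mul]
            congr 1
            ring
        _ ≤ ((6 * σ : ℝ≥0) : ℝ≥0∞) := by
            gcongr
            exact recursion_constant_le n
        _ = _ := by rw [hM, hσ]; congr 1; ring
  refine ⟨main n, fun s d hsd => (step n (fun i _ => main i) s d hsd).trans ?_⟩
  rw [hM, mul_assoc 6, mul_assoc 6]
  gcongr
  refine (inv_le_one_of_one_le₀ (by simp)).trans (by norm_num)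

end CauchyKovalevskaya

/-! ### Local existence of solutions -/

section LocalExistence

open scoped NNReal ENNReal Nat
open Finset.HasAntidiagonal (antidiagonal)

set_option maxSynthPendingDepth 3

variable {E F Y : Type*} [NormedAddCommGroup E] [NormedSpace ℝ E] [NormedAddCommGroup F]
  [NormedSpace ℝ F] [NormedAddCommGroup Y] [NormedSpace ℝ Y]

theorem half_eball_subset {X : Type*} [PseudoEMetricSpace X] (x : X) (ρ : ℝ≥0) :
    Metric.eball x (ρ / 2 : ℝ≥0) ⊆ Metric.eball x ρ :=
  Metric.eball_subset_eball (by exact_mod_cast half_le_self zero_le)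

/-- Termwise differentiation of a series of analytic functions with summable Taylor norms. -/
theorem hasFDerivAt_tsum_of_taylorNorm [CompleteSpace F] {f : ℕ → E → F} {x : E} {ρ : ℝ≥0}
    (hρ0 : 0 < ρ) (hfa : ∀ n, AnalyticOnNhd ℝ (f n) (Metric.eball x ρ))
    (hfsum : ∑' n, taylorNorm ρ (f n) x ≠ ⊤) {z : E} (hz : z ∈ Metric.eball x (ρ / 2 : ℝ≥0)) :
    (Summable fun n => ‖fderiv ℝ (f n) z‖) ∧
      HasFDerivAt (fun y => ∑' n, f n y) (∑' n, fderiv ℝ (f n) z) z := by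
  have hsub := half_eball_subset x ρ
  have hn : ∀ n, taylorNorm ρ (f n) x ≠ ⊤ := fun n =>
    ne_top_of_le_ne_top hfsum (ENNReal.le_tsum n)
  have hρ2 : ρ / 2 ≠ 0 := by positivity
  have h3 : ρ - ρ / 2 = ρ / 2 := by
    rw [tsub_eq_iff_eq_add_of_le (half_le_self zero_le), add_halves]
  have hd : ∀ n, ∀ z ∈ Metric.eball x (ρ / 2 : ℝ≥0),
      ‖fderiv ℝ (f n) z‖ ≤ ((ρ / 2 : ℝ≥0)⁻¹ * (taylorNorm ρ (f n) x).toNNReal : ℝ≥0) := by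
    intro n z hz
    have h1 := enorm_le_taylorNorm ((hfa n).fderiv.mono hsub) hz
    have h2 := taylorNorm_fderiv_le (s := ρ / 2) (half_le_self zero_le) (f n) x
    rw [h3] at h2
    have h4 : ‖fderiv ℝ (f n) z‖ₑ ≤
        (((ρ / 2 : ℝ≥0)⁻¹ * (taylorNorm ρ (f n) x).toNNReal : ℝ≥0) : ℝ≥0∞) := by
      rw [ENNReal.coe_mul, ENNReal.coe_toNNReal (hn n), ENNReal.coe_inv hρ2]
      refine h1.trans ?_
      rw [mul_comm, ← div_eq_mul_inv]
      refine (ENNReal.le_div_iff_mul_le (.inl (by exact_mod_cast hρ2))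
        (.inl ENNReal.coe_ne_top)).2 ?_
      rwa [mul_comm]
    rw [enorm_eq_nnnorm] at h4
    exact_mod_cast h4
  have hdsum : Summable fun n => (((ρ / 2 : ℝ≥0)⁻¹ *
      (taylorNorm ρ (f n) x).toNNReal : ℝ≥0) : ℝ) := by
    refine NNReal.summable_coe.2 (Summable.mul_left _ ?_)
    rw [← ENNReal.tsum_coe_ne_top_iff_summable]
    refine ne_of_eq_of_ne (tsum_congr fun n => ?_) hfsum
    exact ENNReal.coe_toNNReal (hn n)
  have hmem : x ∈ Metric.eball x (ρ / 2 : ℝ≥0) :=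
    Metric.mem_eball_self (by exact_mod_cast (by positivity : 0 < ρ / 2))
  have hf0 : Summable fun n => f n x := by
    refine Summable.of_nnnorm ?_
    rw [← ENNReal.tsum_coe_ne_top_iff_summable]
    refine ne_top_of_le_ne_top hfsum (ENNReal.tsum_le_tsum fun n => ?_)
    exact enorm_le_taylorNorm (hfa n) (hsub hmem)
  refine ⟨Summable.of_nonneg_of_le (fun _ => norm_nonneg _) (fun n => hd n z hz) hdsum,
    hasFDerivAt_tsum_of_isPreconnected hdsum Metric.isOpen_eball (by
      rw [Metric.eball_coe]
      exact (convex_ball _ _).isPreconnected)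
      (fun n z hz => (hfa n z (hsub hz)).differentiableAt.hasFDerivAt) hd hmem hf0 hz⟩

/-- A convergent series `∑ tⁿ uₙ(x)` whose coefficients obey the recursion of the equation solves
the equation. -/
theorem tsum_fderiv_pow_smul_eq [CompleteSpace F] [CompleteSpace Y]
    {T : (E →L[ℝ] F) →L[ℝ] (E →L[ℝ] F) →L[ℝ] Y} {S : Y →L[ℝ] (E →L[ℝ] F) →L[ℝ] F}
    {c : E → ℝ} {u : ℕ → E → F} {z : ℝ × E}
    (hrec : ∀ n, u (n + 1) = fun x => (n + 1 : ℝ)⁻¹ • c x • cubicCoeff T S u n x)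
    (huz : ∀ n, AnalyticAt ℝ (u n) z.2) {f : ℕ → ℝ × E → F}
    (hf : f = fun n z => z.1 ^ n • u n z.2)
    (hsm : Summable fun n => ‖fderiv ℝ (f n) z‖) :
    (∑' n, fderiv ℝ (f n) z) (1, 0) = c z.2 •
        S (T ((∑' n, fderiv ℝ (f n) z).comp (.inr ℝ ℝ E))
          ((∑' n, fderiv ℝ (f n) z).comp (.inr ℝ ℝ E)))
          ((∑' n, fderiv ℝ (f n) z).comp (.inr ℝ ℝ E)) := by
  have hfd' : ∀ n, HasFDerivAt (f n) ((z.1 ^ n) • (fderiv ℝ (u n) z.2).comp (.snd ℝ ℝ E) +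
      ((n * z.1 ^ (n - 1) : ℝ) • ContinuousLinearMap.fst ℝ ℝ E).smulRight (u n z.2)) z := by
    intro n
    have h1 : HasFDerivAt (fun y : ℝ × E => y.1 ^ n)
        ((n * z.1 ^ (n - 1) : ℝ) • ContinuousLinearMap.fst ℝ ℝ E) z := by
      have := (hasDerivAt_pow n z.1).comp_hasFDerivAt z (hasFDerivAt_fst (𝕜 := ℝ) (p := z))
      exact this
    have h2 : HasFDerivAt (fun y : ℝ × E => u n y.2) ((fderiv ℝ (u n) z.2).comp (.snd ℝ ℝ E)) z :=
      (huz n).differentiableAt.hasFDerivAt.comp z hasFDerivAt_snd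
    rw [hf]
    exact h1.smul h2
  set A : ℕ → E →L[ℝ] F := fun n => z.1 ^ n • fderiv ℝ (u n) z.2 with hA
  have hAeq : ∀ n, (fderiv ℝ (f n) z).comp (.inr ℝ ℝ E) = A n := by
    intro n
    rw [(hfd' n).fderiv]
    ext v
    simp [hA]
  have hAsum : Summable fun n => ‖A n‖ := by
    refine Summable.of_nonneg_of_le (fun _ => norm_nonneg _) (fun n => ?_)
      (hsm.mul_right ‖ContinuousLinearMap.inr ℝ ℝ E‖)
    rw [← hAeq]
    exact ContinuousLinearMap.opNorm_comp_le _ _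
  have hAtsum : (∑' n, fderiv ℝ (f n) z).comp (.inr ℝ ℝ E) = ∑' n, A n := by
    have h1 := (ContinuousLinearMap.precomp F (ContinuousLinearMap.inr ℝ ℝ E)).map_tsum hsm.of_norm
    simp only [ContinuousLinearMap.precomp_apply, hAeq] at h1
    exact h1
  have hlhs : (∑' n, fderiv ℝ (f n) z) (1, 0) =
      ∑' n, c z.2 • z.1 ^ n • cubicCoeff T S u n z.2 := by
    have h1 := (ContinuousLinearMap.apply ℝ F ((1, 0) : ℝ × E)).map_tsum hsm.of_norm
    have h1s := (ContinuousLinearMap.apply ℝ F ((1, 0) : ℝ × E)).summable hsm.of_norm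
    simp only [ContinuousLinearMap.apply_apply] at h1 h1s
    rw [h1, h1s.tsum_eq_zero_add, (hfd' 0).fderiv]
    have h2 : ∀ n, fderiv ℝ (f (n + 1)) z (1, 0) = c z.2 • z.1 ^ n • cubicCoeff T S u n z.2 := by
      intro n
      rw [(hfd' (n + 1)).fderiv, hrec]
      have hn : ((n : ℝ) + 1) ≠ 0 := by positivity
      simp only [_root_.add_apply, _root_.smul_apply, ContinuousLinearMap.comp_apply,
        ContinuousLinearMap.coe_snd', map_zero, smul_zero, zero_add,
        ContinuousLinearMap.smulRight_apply, ContinuousLinearMap.coe_fst', smul_eq_mul, mul_one,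
        Nat.add_sub_cancel, smul_smul]
      congr 1
      push_cast
      field_simp
    simp only [h2]
    simp
  have hTA := summable_norm_sum_antidiagonal_bilinear T hAsum hAsum
  rw [hlhs, hAtsum, ← tsum_sum_antidiagonal_bilinear T hAsum hAsum,
    ← tsum_sum_antidiagonal_bilinear S hTA hAsum]
  have hSA := (summable_norm_sum_antidiagonal_bilinear S hTA hAsum).of_norm
  rw [← hSA.tsum_const_smul]
  refine tsum_congr fun n => ?_
  congr 1
  unfold cubicCoeff
  rw [Finset.smul_sum]
  refine Finset.sum_congr rfl fun p hp => ?_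
  have hT : ∑ q ∈ antidiagonal p.1, T (A q.1) (A q.2) = z.1 ^ p.1 • ∑ q ∈ antidiagonal p.1,
      T (fderiv ℝ (u q.1) z.2) (fderiv ℝ (u q.2) z.2) := by
    rw [Finset.smul_sum]
    refine Finset.sum_congr rfl fun q hq => ?_
    rw [← Finset.HasAntidiagonal.mem_antidiagonal.1 hq, pow_add]
    simp only [hA, map_smul, _root_.smul_apply, smul_smul]
    rw [mul_comm]
  rw [hT, ← Finset.HasAntidiagonal.mem_antidiagonal.1 hp, pow_add]
  simp only [hA, map_smul, _root_.smul_apply, smul_smul]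
  rw [mul_comm]

/-- **Cauchy–Kovalevskaya theorem** for the equation `∂ₜU = c(x) S(T(∂ₓU, ∂ₓU), ∂ₓU)` with analytic
initial values `U(0, x) = u₀(x)`, near the point `(0, x₀)`. -/
theorem exists_cauchyKovalevskaya [CompleteSpace F] [CompleteSpace Y]
    (T : (E →L[ℝ] F) →L[ℝ] (E →L[ℝ] F) →L[ℝ] Y) (S : Y →L[ℝ] (E →L[ℝ] F) →L[ℝ] F)
    {c : E → ℝ} {u₀ : E → F} {x₀ : E} (hc : AnalyticAt ℝ c x₀) (hu₀ : AnalyticAt ℝ u₀ x₀) :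
    ∃ r : ℝ≥0, 0 < r ∧ ∃ U : ℝ × E → F, AnalyticOnNhd ℝ U (Metric.eball (0, x₀) r) ∧
      (∀ x, U (0, x) = u₀ x) ∧
      ∀ z ∈ Metric.eball ((0, x₀) : ℝ × E) r, fderiv ℝ U z (1, 0) = c z.2 •
        S (T ((fderiv ℝ U z).comp (.inr ℝ ℝ E)) ((fderiv ℝ U z).comp (.inr ℝ ℝ E)))
          ((fderiv ℝ U z).comp (.inr ℝ ℝ E)) := by
  obtain ⟨u, hu0, hrec⟩ := exists_seq_of_strong_recursion (X := E → F) u₀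
    (fun n v x => (n + 1 : ℝ)⁻¹ • c x • cubicCoeff T S v n x) (by
      intro n v w hvw
      funext x
      congr 2
      unfold cubicCoeff
      refine Finset.sum_congr rfl fun p hp => ?_
      have hp' := Finset.HasAntidiagonal.mem_antidiagonal.1 hp
      rw [hvw p.2 (by omega)]
      congr 2
      refine Finset.sum_congr rfl fun q hq => ?_
      have hq' := Finset.HasAntidiagonal.mem_antidiagonal.1 hq
      rw [hvw q.1 (by omega), hvw q.2 (by omega)])
  have hua : ∀ x, AnalyticAt ℝ c x → AnalyticAt ℝ u₀ x → ∀ n, AnalyticAt ℝ (u n) x := by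
    intro x hcx hux n
    induction n using Nat.strong_induction_on with
    | _ n ih =>
    rcases n with _ | n
    · rwa [hu0]
    · rw [hrec]
      exact (hcx.smul (analyticAt_cubicCoeff fun i hi => ih i (by omega))).const_smul
  -- A radius on which all the data have finite norms.
  obtain ⟨R₁, hR₁, hR₁'⟩ := hc.exists_taylorNorm_ne_top
  obtain ⟨R₂, hR₂, hR₂'⟩ := hu₀.exists_taylorNorm_ne_top
  obtain ⟨R₃, hR₃, hR₃'⟩ := hu₀.fderiv.exists_taylorNorm_ne_top
  obtain ⟨R, hR0, hR₁R, hR₂R, hR₃R⟩ : ∃ R : ℝ≥0, 0 < R ∧ R ≤ R₁ ∧ R ≤ R₂ ∧ R ≤ R₃ :=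
    ⟨min R₁ (min R₂ R₃), by positivity, by simp, by simp, by simp⟩
  have hRc := ne_top_of_le_ne_top hR₁' (taylorNorm_mono hR₁R c x₀)
  have hRu := ne_top_of_le_ne_top hR₂' (taylorNorm_mono hR₂R u₀ x₀)
  have hRd := ne_top_of_le_ne_top hR₃' (taylorNorm_mono hR₃R (fderiv ℝ u₀) x₀)
  obtain ⟨ρ₀, hρ₀, hball⟩ : ∃ ρ₀ : ℝ≥0, 0 < ρ₀ ∧
      ∀ x ∈ Metric.eball x₀ ρ₀, AnalyticAt ℝ c x ∧ AnalyticAt ℝ u₀ x := by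
    obtain ⟨ε, hε, h⟩ := Metric.eventually_nhds_iff_ball.1
      (hc.eventually_analyticAt.and hu₀.eventually_analyticAt)
    lift ε to ℝ≥0 using hε.le
    refine ⟨ε, by exact_mod_cast hε, fun x hx => h x ?_⟩
    rwa [Metric.eball_coe] at hx
  set C : ℝ≥0 := (taylorNorm R c x₀).toNNReal
  obtain ⟨M, hM0, hM⟩ := exists_seq_of_strong_recursion (taylorNorm R (fderiv ℝ u₀) x₀).toNNReal
    (fun n M => (6 * C * (‖S‖₊ * ‖T‖₊)) *
      ∑ p ∈ antidiagonal n, (∑ q ∈ antidiagonal p.1, M q.1 * M q.2) * M p.2) (by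
      intro n v w hvw
      congr 1
      refine Finset.sum_congr rfl fun p hp => ?_
      have hp' := Finset.HasAntidiagonal.mem_antidiagonal.1 hp
      rw [hvw p.2 (by omega)]
      congr 1
      refine Finset.sum_congr rfl fun q hq => ?_
      have hq' := Finset.HasAntidiagonal.mem_antidiagonal.1 hq
      rw [hvw q.1 (by omega), hvw q.2 (by omega)])
  have hest := fun n => (taylorNorm_coeff_le (hua x₀ hc hu₀) hc
    (ENNReal.coe_toNNReal hRc).ge (fun n => by rw [hrec]) (by
      rw [hM0, hu0, ENNReal.coe_toNNReal hRd]) hM n).2 (R / 2) (R / 2) (by simp)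
  obtain ⟨τ, hτ0, hτ⟩ := exists_summable_of_cubic_recursion hM
  set ρ : ℝ≥0 := min (min (τ * (R / 2)) (R / 2)) ρ₀ with hρ
  have hρ0 : 0 < ρ := by positivity
  have hρτ : ρ ≤ τ * (R / 2) := (min_le_left _ _).trans (min_le_left _ _)
  have hρR : ρ ≤ R / 2 := (min_le_left _ _).trans (min_le_right _ _)
  set f : ℕ → ℝ × E → F := fun n z => z.1 ^ n • u n z.2 with hf
  have hρball : ∀ z ∈ Metric.eball ((0, x₀) : ℝ × E) ρ, z.2 ∈ Metric.eball x₀ ρ₀ := by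
    intro z hz
    have h1 : edist z.2 x₀ ≤ edist z (0, x₀) := le_max_right _ _
    exact (h1.trans_lt hz).trans_le (by exact_mod_cast min_le_right _ _)
  have hfa : ∀ n, AnalyticOnNhd ℝ (f n) (Metric.eball (0, x₀) ρ) := by
    intro n z hz
    have hz2 := hρball z hz
    have h1 := hua z.2 (hball _ hz2).1 (hball _ hz2).2 n
    have h2 : AnalyticAt ℝ (fun y : ℝ × E => u n y.2) z :=
      AnalyticAt.fun_comp (f := fun y : ℝ × E => y.2) h1 analyticAt_snd
    exact (analyticAt_fst.pow n).smul h2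
  have hfn : ∀ n, taylorNorm ρ (f n) (0, x₀) ≤ ρ ^ n * taylorNorm ρ (u n) x₀ := fun n =>
    taylorNorm_pow_smul_le (hua x₀ hc hu₀ n) n
  have hfsum : ∑' n, taylorNorm ρ (f n) (0, x₀) ≠ ⊤ := by
    rw [tsum_eq_zero_add' ENNReal.summable]
    refine ENNReal.add_ne_top.2 ⟨?_, ?_⟩
    · refine ne_top_of_le_ne_top hRu ((hfn 0).trans ?_)
      rw [pow_zero, one_mul, hu0]
      exact taylorNorm_mono (hρR.trans (half_le_self zero_le)) _ _
    · have hs : ∑' n, (((R / 2) * (M (n + 1) * τ ^ (n + 1)) : ℝ≥0) : ℝ≥0∞) ≠ ⊤ :=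
        ENNReal.tsum_coe_ne_top_iff_summable.2
          (((NNReal.summable_nat_add_iff 1).2 hτ).mul_left _)
      refine ne_top_of_le_ne_top hs (ENNReal.tsum_le_tsum fun n => ?_)
      calc _ ≤ (ρ : ℝ≥0∞) ^ (n + 1) * taylorNorm ρ (u (n + 1)) x₀ := hfn (n + 1)
        _ ≤ ((τ * (R / 2) : ℝ≥0) : ℝ≥0∞) ^ (n + 1) * taylorNorm (R / 2) (u (n + 1)) x₀ := by
            gcongr
            exact taylorNorm_mono hρR _ _
        _ = ((R / 2 : ℝ≥0) : ℝ≥0∞) * (taylorNorm (R / 2) (u (n + 1)) x₀ *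
              ((R / 2 : ℝ≥0) : ℝ≥0∞) ^ n * (τ : ℝ≥0∞) ^ (n + 1)) := by
            rw [ENNReal.coe_mul]
            ring
        _ ≤ ((R / 2 : ℝ≥0) : ℝ≥0∞) * (M (n + 1) * (τ : ℝ≥0∞) ^ (n + 1)) := by
            gcongr
            exact hest n
        _ = _ := by push_cast; rfl
  have hf0 : ∀ x, HasSum (fun n => f n (0, x)) (u₀ x) := by
    intro x
    have : ∀ n ≠ 0, f n (0, x) = 0 := fun n hn => by simp [hf, hn]
    have h := hasSum_single 0 this
    simpa [hf, hu0] using h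
  refine ⟨ρ / 2, by positivity, fun z => ∑' n, f n z,
    (analyticOnNhd_tsum_of_taylorNorm hρ0 hfa hfsum).mono (half_eball_subset _ _),
    fun x => (hf0 x).tsum_eq, fun z hz => ?_⟩
  obtain ⟨hsm, hder⟩ := hasFDerivAt_tsum_of_taylorNorm hρ0 hfa hfsum hz
  rw [hder.fderiv]
  have hz2 := hball _ (hρball z (half_eball_subset _ _ hz))
  exact tsum_fderiv_pow_smul_eq hrec (hua z.2 hz2.1 hz2.2) rfl hsm

end LocalExistence

/-! ### Uniqueness of analytic solutions -/

section LocalUniqueness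

set_option maxSynthPendingDepth 3

variable {E F Y : Type*} [NormedAddCommGroup E] [NormedSpace ℝ E] [NormedAddCommGroup F]
  [NormedSpace ℝ F] [NormedAddCommGroup Y] [NormedSpace ℝ Y]

/-- The partial derivative `∂ₜg`. -/
noncomputable def timeDeriv (g : ℝ × E → F) (z : ℝ × E) : F := fderiv ℝ g z (1, 0)

/-- The partial derivative `∂ₓg`. -/
noncomputable def spaceDeriv (g : ℝ × E → F) (z : ℝ × E) : E →L[ℝ] F :=
  (fderiv ℝ g z).comp (.inr ℝ ℝ E)

variable {Ω : Set (ℝ × E)} {g : ℝ × E → F}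

theorem AnalyticOnNhd.timeDeriv [CompleteSpace F] (hg : AnalyticOnNhd ℝ g Ω) :
    AnalyticOnNhd ℝ (timeDeriv g) Ω := fun z hz =>
  ((ContinuousLinearMap.apply ℝ F ((1, 0) : ℝ × E)).analyticAt _).comp (hg z hz).fderiv

theorem AnalyticOnNhd.iterate_timeDeriv [CompleteSpace F] (hg : AnalyticOnNhd ℝ g Ω) (n : ℕ) :
    AnalyticOnNhd ℝ (_root_.timeDeriv^[n] g) Ω := by
  induction n with
  | zero => exact hg
  | succ n ih =>
    rw [Function.iterate_succ_apply']
    exact ih.timeDeriv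

theorem spaceDeriv_eq_comp (g : ℝ × E → F) :
    spaceDeriv g = ContinuousLinearMap.precomp F (ContinuousLinearMap.inr ℝ ℝ E) ∘ fderiv ℝ g :=
  rfl

theorem AnalyticOnNhd.spaceDeriv [CompleteSpace F] (hg : AnalyticOnNhd ℝ g Ω) :
    AnalyticOnNhd ℝ (spaceDeriv g) Ω := by
  intro z hz
  rw [spaceDeriv_eq_comp]
  exact ((ContinuousLinearMap.precomp F (ContinuousLinearMap.inr ℝ ℝ E)).analyticAt _).comp
    (hg z hz).fderiv

theorem timeDeriv_spaceDeriv [CompleteSpace F] (hg : AnalyticOnNhd ℝ g Ω) :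
    EqOn (timeDeriv (spaceDeriv g)) (spaceDeriv (timeDeriv g)) Ω := by
  intro z hz
  have hsymm := (hg z hz).contDiffAt (n := ω) |>.isSymmSndFDerivAt (by simp)
  have hd := (hg z hz).fderiv.differentiableAt
  ext v
  have h1 : HasFDerivAt (spaceDeriv g) ((ContinuousLinearMap.precomp F
      (ContinuousLinearMap.inr ℝ ℝ E)).comp (fderiv ℝ (fderiv ℝ g) z)) z := by
    rw [spaceDeriv_eq_comp]
    exact (ContinuousLinearMap.precomp F (ContinuousLinearMap.inr ℝ ℝ E)).hasFDerivAt.comp z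
      hd.hasFDerivAt
  have h2 : HasFDerivAt (timeDeriv g) ((ContinuousLinearMap.apply ℝ F ((1, 0) : ℝ × E)).comp
      (fderiv ℝ (fderiv ℝ g) z)) z :=
    (ContinuousLinearMap.apply ℝ F ((1, 0) : ℝ × E)).hasFDerivAt.comp z hd.hasFDerivAt
  have h3 : timeDeriv (spaceDeriv g) z v = fderiv ℝ (fderiv ℝ g) z (1, 0) (0, v) := by
    rw [timeDeriv, h1.fderiv]
    simp
  have h4 : spaceDeriv (timeDeriv g) z v = fderiv ℝ (fderiv ℝ g) z (0, v) (1, 0) := by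
    rw [spaceDeriv, h2.fderiv]
    simp
  rw [h3, h4]
  exact hsymm.eq _ _

theorem iterate_timeDeriv_spaceDeriv [CompleteSpace F] (hΩ : IsOpen Ω)
    (hg : AnalyticOnNhd ℝ g Ω) (n : ℕ) :
    EqOn (timeDeriv^[n] (spaceDeriv g)) (spaceDeriv (timeDeriv^[n] g)) Ω := by
  induction n with
  | zero => exact fun _ _ => rfl
  | succ n ih =>
    intro z hz
    rw [Function.iterate_succ_apply', Function.iterate_succ_apply',
      ← timeDeriv_spaceDeriv (hg.iterate_timeDeriv n) hz, timeDeriv, timeDeriv,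
      (ih.eventuallyEq_of_mem (hΩ.mem_nhds hz)).fderiv_eq]

theorem AnalyticAt.comp_time {t : ℝ} {x : E} (hg : AnalyticAt ℝ g (t, x)) :
    AnalyticAt ℝ (fun s => g (s, x)) t :=
  AnalyticAt.fun_comp (f := fun s : ℝ => (s, x)) hg (analyticAt_id.prod analyticAt_const)

theorem iteratedDeriv_time_eq [CompleteSpace F] (hΩ : IsOpen Ω) (hg : AnalyticOnNhd ℝ g Ω)
    {x : E} (n : ℕ) : ∀ t, (t, x) ∈ Ω →
      iteratedDeriv n (fun s => g (s, x)) t = timeDeriv^[n] g (t, x) := by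
  induction n with
  | zero => intro t _; simp
  | succ n ih =>
    intro t ht
    rw [iteratedDeriv_succ, Function.iterate_succ_apply']
    have hev : iteratedDeriv n (fun s => g (s, x)) =ᶠ[𝓝 t] fun s => timeDeriv^[n] g (s, x) := by
      have : ∀ᶠ s in 𝓝 t, (s, x) ∈ Ω :=
        (Continuous.prodMk_left x).continuousAt.eventually (hΩ.mem_nhds ht)
      filter_upwards [this] with s hs using ih s hs
    rw [hev.deriv_eq]
    have h1 := ((hg.iterate_timeDeriv n) _ ht).differentiableAt.hasFDerivAt
    have h2 : HasDerivAt (fun s : ℝ => (s, x)) ((1 : ℝ), (0 : E)) t :=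
      (hasDerivAt_id t).prodMk (hasDerivAt_const t x)
    exact (h1.comp_hasDerivAt t h2).deriv

/-- Uniqueness of analytic solutions of `∂ₜU = c(x) S(T(∂ₓU, ∂ₓU), ∂ₓU)` with given initial values:
by the equation all time derivatives of the difference of two solutions vanish at time zero. -/
theorem eqOn_of_cauchyKovalevskaya [CompleteSpace F] [CompleteSpace Y]
    {T : (E →L[ℝ] F) →L[ℝ] (E →L[ℝ] F) →L[ℝ] Y} {S : Y →L[ℝ] (E →L[ℝ] F) →L[ℝ] F}
    {c : E → ℝ} {ε : ℝ} (hε : 0 < ε) {V : Set E} (hV : IsOpen V) {a b : ℝ × E → F}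
    (ha : AnalyticOnNhd ℝ a (Ioo (-ε) ε ×ˢ V)) (hb : AnalyticOnNhd ℝ b (Ioo (-ε) ε ×ˢ V))
    (ha' : ∀ z ∈ Ioo (-ε) ε ×ˢ V, timeDeriv a z =
      c z.2 • S (T (spaceDeriv a z) (spaceDeriv a z)) (spaceDeriv a z))
    (hb' : ∀ z ∈ Ioo (-ε) ε ×ˢ V, timeDeriv b z =
      c z.2 • S (T (spaceDeriv b z) (spaceDeriv b z)) (spaceDeriv b z))
    (hab : ∀ x ∈ V, a (0, x) = b (0, x)) : EqOn a b (Ioo (-ε) ε ×ˢ V) := by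
  set Ω := Ioo (-ε) ε ×ˢ V with hΩ
  have hΩo : IsOpen Ω := isOpen_Ioo.prod hV
  have h0 : ∀ x ∈ V, ((0 : ℝ), x) ∈ Ω := fun x hx => ⟨⟨by simpa, by simpa⟩, hx⟩
  set w : ℝ × E → F := fun z => a z - b z with hw
  have hwa : AnalyticOnNhd ℝ w Ω := ha.sub hb
  have hfd : ∀ z ∈ Ω, fderiv ℝ w z = fderiv ℝ a z - fderiv ℝ b z := fun z hz =>
    fderiv_fun_sub (ha z hz).differentiableAt (hb z hz).differentiableAt
  have hws : ∀ z ∈ Ω, spaceDeriv w z = spaceDeriv a z - spaceDeriv b z := fun z hz => by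
    ext v; simp [spaceDeriv, hfd z hz]
  have hwt : ∀ z ∈ Ω, timeDeriv w z = timeDeriv a z - timeDeriv b z := fun z hz => by
    simp [timeDeriv, hfd z hz]
  have key : ∀ n, ∀ x ∈ V, ∀ i < n, timeDeriv^[i] w (0, x) = 0 := by
    intro n
    induction n with
    | zero => intro x _ i hi; omega
    | succ n ih =>
      intro x hx i hi
      rcases i with _ | i
      · simp [hw, hab x hx]
      -- `∂ₓw` vanishes to order `n` in time along `{0} × V`, hence so does `∂ₜw`.
      have hsp : (n : ℕ∞) ≤ analyticOrderAt (fun t => spaceDeriv w (t, x)) 0 := by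
        rw [natCast_le_analyticOrderAt_iff_iteratedDeriv_eq_zero
          (hwa.spaceDeriv _ (h0 x hx)).comp_time]
        intro j hj
        rw [iteratedDeriv_time_eq hΩo hwa.spaceDeriv j 0 (h0 x hx),
          iterate_timeDeriv_spaceDeriv hΩo hwa j (h0 x hx)]
        ext v
        have h1 := (hwa.iterate_timeDeriv j _ (h0 x hx)).differentiableAt.hasFDerivAt
        have h2 : HasFDerivAt (fun y : E => ((0 : ℝ), y)) (ContinuousLinearMap.inr ℝ ℝ E) x :=
          (hasFDerivAt_const _ _).prodMk (hasFDerivAt_id x)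
        have h3 := h1.comp x h2
        have h4 : (timeDeriv^[j] w ∘ fun y : E => ((0 : ℝ), y)) =ᶠ[𝓝 x] fun _ => 0 := by
          filter_upwards [hV.mem_nhds hx] with y hy using ih y hy j hj
        have h5 := h3.unique ((hasFDerivAt_const (0 : F) x).congr_of_eventuallyEq h4)
        rw [spaceDeriv, h5]
      have htm : (n : ℕ∞) ≤ analyticOrderAt (fun t => timeDeriv w (t, x)) 0 := by
        obtain ⟨h, hha, hh⟩ := (natCast_le_analyticOrderAt
          (hwa.spaceDeriv _ (h0 x hx)).comp_time).1 hsp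
        refine (natCast_le_analyticOrderAt (hwa.timeDeriv _ (h0 x hx)).comp_time).2 ?_
        have hA := (ha.spaceDeriv _ (h0 x hx)).comp_time
        have hB := (hb.spaceDeriv _ (h0 x hx)).comp_time
        refine ⟨fun t => c x • (S (T (h t) (spaceDeriv a (t, x))) (spaceDeriv a (t, x)) +
          S (T (spaceDeriv b (t, x)) (h t)) (spaceDeriv a (t, x)) +
          S (T (spaceDeriv b (t, x)) (spaceDeriv b (t, x))) (h t)), ?_, ?_⟩
        · refine AnalyticAt.const_smul ?_
          exact ((analyticAt_bilinear S (analyticAt_bilinear T hha hA) hA).add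
            (analyticAt_bilinear S (analyticAt_bilinear T hB hha) hA)).add
            (analyticAt_bilinear S (analyticAt_bilinear T hB hB) hha)
        · have : ∀ᶠ t in 𝓝 (0 : ℝ), (t, x) ∈ Ω :=
            (Continuous.prodMk_left x).continuousAt.eventually (hΩo.mem_nhds (h0 x hx))
          filter_upwards [hh, this] with t ht htΩ
          rw [hwt _ htΩ, ha' _ htΩ, hb' _ htΩ]
          have h1 : spaceDeriv a (t, x) = spaceDeriv b (t, x) + (t - 0) ^ n • h t := by
            rw [← ht, hws _ htΩ]; abel
          generalize hgA : spaceDeriv a (t, x) = A at h1 ⊢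
          generalize spaceDeriv b (t, x) = B at h1 ⊢
          have h2 : S (T A A) A - S (T B B) B = S (T (A - B) A) A + S (T B (A - B)) A +
              S (T B B) (A - B) := by
            simp only [map_sub, _root_.sub_apply]
            abel
          have h3 : A - B = (t - 0) ^ n • h t := by rw [h1]; abel
          rw [← smul_sub, h2, h3]
          simp only [map_smul, _root_.smul_apply, smul_add, smul_smul, mul_comm]
      rw [natCast_le_analyticOrderAt_iff_iteratedDeriv_eq_zero
        (hwa.timeDeriv _ (h0 x hx)).comp_time] at htm
      have := htm i (by omega)
      rw [iteratedDeriv_time_eq hΩo hwa.timeDeriv i 0 (h0 x hx)] at this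
      rwa [Function.iterate_succ_apply]
  rintro ⟨t, x⟩ ⟨ht, hx⟩
  have hline : AnalyticOnNhd ℝ (fun s => w (s, x)) (Ioo (-ε) ε) := fun s hs =>
    (hwa (s, x) ⟨hs, hx⟩).comp_time
  have htop : analyticOrderAt (fun s => w (s, x)) 0 = ⊤ := by
    rw [ENat.eq_top_iff_forall_ge]
    intro n
    rw [natCast_le_analyticOrderAt_iff_iteratedDeriv_eq_zero (hwa _ (h0 x hx)).comp_time]
    intro i hi
    rw [iteratedDeriv_time_eq hΩo hwa i 0 (h0 x hx)]
    exact key n x hx i hi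
  have := hline.eqOn_zero_of_preconnected_of_eventuallyEq_zero isPreconnected_Ioo
    (h0 x hx).1 (analyticOrderAt_eq_top.1 htop) ht
  exact sub_eq_zero.1 this

end LocalUniqueness

/-! ### The triple cross product of `ℝ⁸` -/

section TripleCrossProduct

/-- The matrix of the bilinear form `(w, y) ↦ Φ₀(u, v, w, y)`. Its entries are signed sums of the
coordinates `uⱼvₖ - uₖvⱼ` of `u ∧ v`. -/
def crossMatrix (u v : E8) : Matrix (Fin 8) (Fin 8) ℝ :=
  let p (j k : Fin 8) : ℝ := u j * v k - u k * v j
  !![0, p 2 3 + p 4 5 + p 6 7, -p 1 3 + p 4 6 - p 5 7,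
      p 1 2 - p 4 7 - p 5 6, -p 1 5 - p 2 6 + p 3 7, p 1 4 + p 2 7 + p 3 6,
      -p 1 7 + p 2 4 - p 3 5, p 1 6 - p 2 5 - p 3 4;
     -p 2 3 - p 4 5 - p 6 7, 0, p 0 3 - p 5 6 - p 4 7,
      -p 0 2 + p 5 7 - p 4 6, p 0 5 + p 3 6 + p 2 7, -p 0 4 - p 3 7 + p 2 6,
      p 0 7 - p 3 4 - p 2 5, -p 0 6 + p 3 5 - p 2 4;
     p 1 3 - p 4 6 + p 5 7, -p 0 3 + p 5 6 + p 4 7, 0,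
      p 0 1 + p 6 7 + p 4 5, p 0 6 - p 3 5 - p 1 7, -p 0 7 + p 3 4 - p 1 6,
      -p 0 4 - p 3 7 + p 1 5, p 0 5 + p 3 6 + p 1 4;
     -p 1 2 + p 4 7 + p 5 6, p 0 2 - p 5 7 + p 4 6, -p 0 1 - p 6 7 - p 4 5,
      0, -p 0 7 + p 2 5 - p 1 6, -p 0 6 - p 2 4 + p 1 7,
      p 0 5 + p 2 7 + p 1 4, p 0 4 - p 2 6 - p 1 5;
     p 1 5 + p 2 6 - p 3 7, -p 0 5 - p 3 6 - p 2 7, -p 0 6 + p 3 5 + p 1 7,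
      p 0 7 - p 2 5 + p 1 6, 0, p 0 1 + p 6 7 + p 2 3,
      p 0 2 - p 5 7 - p 1 3, -p 0 3 + p 5 6 - p 1 2;
     -p 1 4 - p 2 7 - p 3 6, p 0 4 + p 3 7 - p 2 6, p 0 7 - p 3 4 + p 1 6,
      p 0 6 + p 2 4 - p 1 7, -p 0 1 - p 6 7 - p 2 3, 0,
      -p 0 3 + p 4 7 - p 1 2, -p 0 2 - p 4 6 + p 1 3;
     p 1 7 - p 2 4 + p 3 5, -p 0 7 + p 3 4 + p 2 5, p 0 4 + p 3 7 - p 1 5,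
      -p 0 5 - p 2 7 - p 1 4, -p 0 2 + p 5 7 + p 1 3, p 0 3 - p 4 7 + p 1 2,
      0, p 0 1 + p 4 5 + p 2 3;
     -p 1 6 + p 2 5 + p 3 4, p 0 6 - p 3 5 + p 2 4, -p 0 5 - p 3 6 - p 1 4,
      -p 0 4 + p 2 6 + p 1 5, p 0 3 - p 5 6 + p 1 2, p 0 2 + p 4 6 - p 1 3,
      -p 0 1 - p 4 5 - p 2 3, 0]

theorem dx4_apply_eq (i j k l : Fin 8) (u v w y : E8) : dx4 i j k l ![u, v, w, y] =
    (u i * v j - u j * v i) * (w k * y l - w l * y k) -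
    (u i * v k - u k * v i) * (w j * y l - w l * y j) +
    (u i * v l - u l * v i) * (w j * y k - w k * y j) +
    (u j * v k - u k * v j) * (w i * y l - w l * y i) -
    (u j * v l - u l * v j) * (w i * y k - w k * y i) +
    (u k * v l - u l * v k) * (w i * y j - w j * y i) := by
  rw [dx4_apply]
  simp [Matrix.det_succ_row_zero, Fin.sum_univ_succ, Fin.succAbove, Matrix.of_apply]
  ring

set_option maxHeartbeats 1000000 in
theorem Phi0_apply_eq_crossMatrix (u v w y : E8) :
    Phi0 ![u, v, w, y] = ∑ a, ∑ b, crossMatrix u v a b * (w a * y b) := by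
  simp only [Phi0, AlternatingMap.add_apply, AlternatingMap.sub_apply, dx4_apply_eq]
  simp [Fin.sum_univ_eight, crossMatrix]
  ring

set_option maxHeartbeats 4000000 in
/-- For the skew matrix `B` of `Φ₀(u, v, ·, ·)`, the matrix `B Bᵀ` is `|u ∧ v|²` times the
orthogonal projection onto the complement of the span of `u` and `v`. This quadratic identity in the
coefficients of `Φ₀` is what makes the vectors `u, v, w` and their cross product span a calibrated
plane; it is checked entry by entry. -/
theorem sum_crossMatrix_mul_crossMatrix (u v : E8) (l m : Fin 8) :
    ∑ e, crossMatrix u v l e * crossMatrix u v m e =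
      ((∑ i, u i * u i) * (∑ i, v i * v i) - (∑ i, u i * v i) ^ 2) * (if l = m then 1 else 0) -
      ((∑ i, v i * v i) * u l * u m + (∑ i, u i * u i) * v l * v m -
        (∑ i, u i * v i) * (u l * v m + u m * v l)) := by
  wlog h : l ≤ m generalizing l m
  · simp_rw [mul_comm (crossMatrix u v l _)]
    rw [this m l (le_of_not_ge h)]
    simp only [eq_comm (a := m)]
    ring
  fin_cases l <;> fin_cases m <;>
    first
    | exact absurd h (by decide)
    | (simp [Fin.sum_univ_eight, crossMatrix]; ring)

open Matrix (gram)

/-- The triple cross product of `ℝ⁸` defined by `Φ₀`: the vector `z` with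
`⟨z, y⟩ = Φ₀(u, v, w, y)` for all `y`. -/
noncomputable def tripleCross (u v w : E8) : E8 :=
  contractPhi0 (exteriorPower.ιMulti ℝ 3 ![u, v, w])

theorem tripleCross_apply (u v w : E8) (e : Fin 8) :
    tripleCross u v w e = ∑ a, crossMatrix u v a e * w a := by
  rw [tripleCross, contractPhi0_wedge, Phi0_apply_eq_crossMatrix]
  simp

theorem inner_tripleCross (u v w y : E8) : inner ℝ (tripleCross u v w) y = Phi0 ![u, v, w, y] := by
  rw [Phi0_apply_eq_crossMatrix, Finset.sum_comm, PiLp.inner_apply]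
  refine Finset.sum_congr rfl fun b _ => ?_
  rw [tripleCross_apply]
  simp only [RCLike.inner_apply, conj_trivial, Finset.mul_sum]
  exact Finset.sum_congr rfl fun a _ => by ring

/-- The triple cross product has the norm of the 3-vector `u ∧ v ∧ w`. -/
theorem inner_tripleCross_self (u v w : E8) :
    inner ℝ (tripleCross u v w) (tripleCross u v w) = (gram ℝ ![u, v, w]).det := by
  have hin : ∀ x y : E8, inner ℝ x y = ∑ i, x i * y i := fun x y => by
    simp [PiLp.inner_apply, mul_comm]
  have h1 : inner ℝ (tripleCross u v w) (tripleCross u v w) = ∑ l, ∑ m, w l * w m *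
      ∑ e, crossMatrix u v l e * crossMatrix u v m e := by
    rw [hin]
    simp_rw [tripleCross_apply, Finset.sum_mul_sum, Finset.mul_sum]
    rw [Finset.sum_comm]
    refine Finset.sum_congr rfl fun l _ => ?_
    rw [Finset.sum_comm]
    exact Finset.sum_congr rfl fun m _ => Finset.sum_congr rfl fun e _ => by ring
  have h2 : ∀ (a b : E8) (k : ℝ), ∑ l, ∑ m, w l * w m * (k * a l * b m) =
      k * (∑ l, a l * w l) * ∑ m, b m * w m := fun a b k => by
    rw [mul_assoc, Finset.sum_mul_sum, Finset.mul_sum]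
    refine Finset.sum_congr rfl fun l _ => ?_
    rw [Finset.mul_sum]
    exact Finset.sum_congr rfl fun m _ => by ring
  have h3 : ∀ k : ℝ, ∑ l, ∑ m, w l * w m * (k * (if l = m then 1 else 0)) =
      k * ∑ l, w l * w l := fun k => by
    rw [Finset.mul_sum]
    exact Finset.sum_congr rfl fun l _ => by simp; ring
  have h4 : ∀ l m : Fin 8, w l * w m * ∑ e, crossMatrix u v l e * crossMatrix u v m e =
      w l * w m * (((∑ i, u i * u i) * (∑ i, v i * v i) - (∑ i, u i * v i) ^ 2) *
        (if l = m then 1 else 0)) - w l * w m * ((∑ i, v i * v i) * u l * u m) -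
      w l * w m * ((∑ i, u i * u i) * v l * v m) + w l * w m * ((∑ i, u i * v i) * u l * v m) +
      w l * w m * ((∑ i, u i * v i) * v l * u m) := fun l m => by
    rw [sum_crossMatrix_mul_crossMatrix]
    ring
  rw [h1]
  simp_rw [h4, Finset.sum_add_distrib, Finset.sum_sub_distrib]
  rw [h2, h2, h2, h2, h3, Matrix.det_fin_three]
  simp only [Matrix.gram_apply, hin]
  simp only [Matrix.cons_val_zero, Matrix.cons_val_one, Matrix.cons_val]
  have hc : ∀ a b : E8, ∑ i, a i * b i = ∑ i, b i * a i := fun a b =>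
    Finset.sum_congr rfl fun i _ => mul_comm _ _
  rw [hc v u, hc w u, hc w v]
  ring

theorem tripleCross_ne_zero {u v w : E8} (h : LinearIndependent ℝ ![u, v, w]) :
    tripleCross u v w ≠ 0 := by
  rw [← inner_self_ne_zero (𝕜 := ℝ), inner_tripleCross_self]
  exact Matrix.det_gram_ne_zero_iff_linearIndependent.2 h

theorem Phi0_tripleCross_smul (u v w : E8) (c : ℝ) :
    Phi0 ![u, v, w, c • tripleCross u v w] =
      c * inner ℝ (tripleCross u v w) (tripleCross u v w) := by
  rw [← inner_tripleCross, inner_smul_right]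

/-- On `u, v, w` and a multiple of their cross product, `Φ₀` is up to sign the four-dimensional
volume. -/
theorem det_gram_tripleCross (u v w : E8) (c : ℝ) :
    (gram ℝ ![u, v, w, c • tripleCross u v w]).det =
      Phi0 ![u, v, w, c • tripleCross u v w] ^ 2 := by
  have hz : ∀ y ∈ ({u, v, w} : Set E8), inner ℝ (tripleCross u v w) y = 0 := by
    rintro y (rfl | rfl | rfl) <;> rw [inner_tripleCross]
    · exact Phi0.map_eq_zero_of_eq _ (i := 0) (j := 3) rfl (by decide)
    · exact Phi0.map_eq_zero_of_eq _ (i := 1) (j := 3) rfl (by decide)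
    · exact Phi0.map_eq_zero_of_eq _ (i := 2) (j := 3) rfl (by decide)
  have hu := hz u (by simp)
  have hv := hz v (by simp)
  have hw := hz w (by simp)
  have hu' : inner ℝ u (tripleCross u v w) = 0 := by rw [real_inner_comm, hu]
  have hv' : inner ℝ v (tripleCross u v w) = 0 := by rw [real_inner_comm, hv]
  have hw' : inner ℝ w (tripleCross u v w) = 0 := by rw [real_inner_comm, hw]
  have h3 : (gram ℝ ![u, v, w, c • tripleCross u v w]).det =
      (c * (c * inner ℝ (tripleCross u v w) (tripleCross u v w))) * (gram ℝ ![u, v, w]).det := by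
    rw [Matrix.det_succ_row _ 3, Fin.sum_univ_four]
    simp only [Matrix.gram_apply]
    have h : (gram ℝ ![u, v, w, c • tripleCross u v w]).submatrix (Fin.succAbove 3)
        (Fin.succAbove 3) = gram ℝ ![u, v, w] := by
      ext i j
      fin_cases i <;> fin_cases j <;> rfl
    rw [h]
    have e0 : ![u, v, w, c • tripleCross u v w] 0 = u := rfl
    have e1 : ![u, v, w, c • tripleCross u v w] 1 = v := rfl
    have e2 : ![u, v, w, c • tripleCross u v w] 2 = w := rfl
    have e3 : ![u, v, w, c • tripleCross u v w] 3 = c • tripleCross u v w := rfl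
    rw [e0, e1, e2, e3]
    simp only [real_inner_smul_left, real_inner_smul_right, hu, hv, hw]
    norm_num [pow_succ]
  rw [h3, ← inner_tripleCross_self, Phi0_tripleCross_smul]
  ring

/-- A four-plane spanned by `u, v, w` and a multiple of their triple cross product is a Cayley
plane: `Φ₀` takes the values `±1` on its orthonormal bases. -/
theorem Phi0_sq_eq_one_of_orthonormal {M : Type*} [AddCommGroup M] [Module ℝ M]
    (L : M →ₗ[ℝ] E8) (b : Module.Basis (Fin 4) ℝ M) (hb : Orthonormal ℝ fun i => L (b i))
    {m : Fin 4 → M} {c : ℝ} (hm : L (m 3) = c • tripleCross (L (m 0)) (L (m 1)) (L (m 2)))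
    (h0 : Phi0 (fun i => L (m i)) ≠ 0) : Phi0 (fun i => L (b i)) ^ 2 = 1 := by
  have h1 : Phi0 (fun i => L (m i)) = Phi0 (fun i => L (b i)) * b.det m := by
    have := congrArg (fun f => f m) ((Phi0.compLinearMap L).eq_smul_basis_det b)
    simpa [Function.comp_def] using this
  have hLm : (fun i => L (m i)) = ![L (m 0), L (m 1), L (m 2),
      c • tripleCross (L (m 0)) (L (m 1)) (L (m 2))] := by
    rw [← hm]
    ext i
    fin_cases i <;> rfl
  have h2 : (gram ℝ fun i => L (m i)).det = b.det m ^ 2 := by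
    have h3 : gram ℝ (fun i => L (m i)) = (b.toMatrix m).transpose * b.toMatrix m := by
      ext i j
      rw [Matrix.gram_apply, Matrix.mul_apply]
      have hexp : ∀ i, L (m i) = ∑ k, b.toMatrix m k i • L (b k) := fun i => by
        simp_rw [← map_smul, ← map_sum, b.sum_toMatrix_smul_self]
      rw [hexp i, hexp j, hb.inner_sum]
      simp
    rw [h3, Matrix.det_mul, Matrix.det_transpose, ← Module.Basis.det_apply, pow_two]
  have h4 : b.det m ≠ 0 := fun h => h0 (by rw [h1, h, mul_zero])
  have h5 : Phi0 (fun i => L (m i)) ^ 2 = b.det m ^ 2 := by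
    rw [← h2, hLm, det_gram_tripleCross]
  rw [h1, mul_pow] at h5
  exact mul_right_cancel₀ (pow_ne_zero 2 h4) (h5.trans (one_mul _).symm)

theorem tripleCross_swap (u v w : E8) : tripleCross v u w = -tripleCross u v w := by
  ext e
  simp only [tripleCross, contractPhi0_wedge, PiLp.neg_apply]
  have h := Phi0.map_swap ![u, v, w, EuclideanSpace.single e 1] (i := 0) (j := 1) (by decide)
  rw [← h]
  congr 1
  ext i
  fin_cases i <;> rfl

theorem tripleCross_add_left (u u' v w : E8) :
    tripleCross (u + u') v w = tripleCross u v w + tripleCross u' v w := by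
  ext e
  simp [tripleCross, contractPhi0_wedge, Phi0.map_vecCons_add]

theorem tripleCross_smul_left (a : ℝ) (u v w : E8) :
    tripleCross (a • u) v w = a • tripleCross u v w := by
  ext e
  simp [tripleCross, contractPhi0_wedge, Phi0.map_vecCons_smul]

/-- The triple cross product as a linear map in each variable. -/
noncomputable def tripleCrossLin : E8 →ₗ[ℝ] E8 →ₗ[ℝ] (E8 →L[ℝ] E8) :=
  LinearMap.mk₂ ℝ (fun u v => LinearMap.toContinuousLinearMap
    { toFun := tripleCross u v
      map_add' := fun w w' => by
        ext e
        simp [tripleCross_apply, mul_add, Finset.sum_add_distrib]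
      map_smul' := fun a w => by
        ext e
        simp [tripleCross_apply, Finset.mul_sum, mul_left_comm] })
    (fun u u' v => ContinuousLinearMap.ext fun w => tripleCross_add_left u u' v w)
    (fun a u v => ContinuousLinearMap.ext fun w => tripleCross_smul_left a u v w)
    (fun u v v' => ContinuousLinearMap.ext fun w => show tripleCross u (v + v') w =
        tripleCross u v w + tripleCross u v' w by
      rw [tripleCross_swap (v + v'), tripleCross_add_left, tripleCross_swap u v,
        tripleCross_swap u v', neg_add, neg_neg, neg_neg])
    (fun a u v => ContinuousLinearMap.ext fun w => show tripleCross u (a • v) w =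
        a • tripleCross u v w by
      rw [tripleCross_swap (a • v), tripleCross_smul_left, tripleCross_swap u v, smul_neg,
        neg_neg])

/-- The bilinear map `(A, B) ↦ tripleCross (A e₁) (B e₂)`, the inner map in the factorization of
`(A, B, C) ↦ tripleCross (A e₁) (B e₂) (C e₃)` into two bilinear maps. -/
noncomputable def crossInner : (E3 →L[ℝ] E8) →L[ℝ] (E3 →L[ℝ] E8) →L[ℝ] (E8 →L[ℝ] E8) :=
  tripleCrossLin.toContinuousBilinearMap.bilinearComp
    (ContinuousLinearMap.apply ℝ E8 (EuclideanSpace.single 0 1))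
    (ContinuousLinearMap.apply ℝ E8 (EuclideanSpace.single 1 1))

/-- The bilinear map `(y, C) ↦ y (C e₃)`, the outer map in the factorization of
`(A, B, C) ↦ tripleCross (A e₁) (B e₂) (C e₃)` into two bilinear maps. -/
noncomputable def crossOuter : (E8 →L[ℝ] E8) →L[ℝ] (E3 →L[ℝ] E8) →L[ℝ] E8 :=
  (ContinuousLinearMap.id ℝ (E8 →L[ℝ] E8)).bilinearComp (.id ℝ _)
    (ContinuousLinearMap.apply ℝ E8 (EuclideanSpace.single 2 1))

theorem crossOuter_crossInner (A B C : E3 →L[ℝ] E8) :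
    crossOuter (crossInner A B) C = tripleCross (A (EuclideanSpace.single 0 1))
      (B (EuclideanSpace.single 1 1)) (C (EuclideanSpace.single 2 1)) := rfl

end TripleCrossProduct

/-! ### The evolution equation in coordinates -/

section ChartCoefficient

theorem alternatingMapLinearEquiv_eq_mul_coeff3 (φ : E3 [⋀^Fin 3]→ₗ[ℝ] ℝ) (η : ⋀[ℝ]^3 E3) :
    exteriorPower.alternatingMapLinearEquiv φ η =
      φ (fun i => EuclideanSpace.single i 1) * coeff3 η := by
  have h := φ.eq_smul_basis_det (EuclideanSpace.basisFun (Fin 3) ℝ).toBasis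
  have h' : φ = φ (fun i => EuclideanSpace.single i 1) •
      (EuclideanSpace.basisFun (Fin 3) ℝ).toBasis.det := by
    convert h using 3
    ext i
    simp
  conv_lhs => rw [h', map_smul]
  rfl

theorem coeff3_ne_zero {η : ⋀[ℝ]^3 E3} (h : η ≠ 0) : coeff3 η ≠ 0 := fun h0 => by
  refine h ((Module.forall_dual_apply_eq_zero_iff ℝ η).1 fun f => ?_)
  obtain ⟨φ, rfl⟩ := exteriorPower.alternatingMapLinearEquiv.surjective f
  rw [alternatingMapLinearEquiv_eq_mul_coeff3, h0, mul_zero]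

/-- The space of 3-vectors on `ℝ³` is a line, so the contraction of the push-forward of any 3-vector
is a multiple of one triple cross product. -/
theorem contractPhi0_map (A : E3 →ₗ[ℝ] E8) (η : ⋀[ℝ]^3 E3) :
    contractPhi0 (exteriorPower.map 3 A η) = coeff3 η • tripleCross
      (A (EuclideanSpace.single 0 1)) (A (EuclideanSpace.single 1 1))
      (A (EuclideanSpace.single 2 1)) := by
  ext e
  have h : exteriorPower.alternatingMapLinearEquiv (Phi0Last (EuclideanSpace.single e 1)) ∘ₗ
      exteriorPower.map 3 A = exteriorPower.alternatingMapLinearEquiv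
        ((Phi0Last (EuclideanSpace.single e 1)).compLinearMap A) := by
    refine exteriorPower.linearMap_ext (AlternatingMap.ext fun m => ?_)
    simp [exteriorPower.map_apply_ιMulti, Function.comp_def]
  have h1 := congrArg (fun f => f η) h
  simp only [LinearMap.comp_apply, alternatingMapLinearEquiv_eq_mul_coeff3] at h1
  change exteriorPower.alternatingMapLinearEquiv (Phi0Last (EuclideanSpace.single e 1))
    (exteriorPower.map 3 A η) = _
  rw [h1, PiLp.smul_apply, tripleCross, contractPhi0_wedge, smul_eq_mul, mul_comm,
    ← Phi0Last_apply]
  have h2 : ![A (EuclideanSpace.single 0 1), A (EuclideanSpace.single 1 1),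
      A (EuclideanSpace.single 2 1)] = fun i : Fin 3 => A (EuclideanSpace.single i 1) := by
    funext i
    fin_cases i <;> rfl
  rw [h2, AlternatingMap.compLinearMap_apply]

variable {P : Type*} [TopologicalSpace P] [ChartedSpace E3 P]

/-- The coefficient of `χ p` with respect to the coordinates `(x₁, x₂, x₃)` of the preferred chart
at `q`: the number `c` with `χ p = c ∂₁ ∧ ∂₂ ∧ ∂₃`. -/
noncomputable def chartCoeff (χ : (p : P) → ⋀[ℝ]^3 (TangentSpace 𝓘(ℝ, E3) p)) (q p : P) : ℝ :=
  coeff3 (exteriorPower.map (M := TangentSpace 𝓘(ℝ, E3) p) (N := E3) 3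
    (mfderiv 𝓘(ℝ, E3) 𝓘(ℝ, E3) (extChartAt 𝓘(ℝ, E3) q) p).toLinearMap (χ p))

variable [IsManifold 𝓘(ℝ, E3) ω P] {χ : (p : P) → ⋀[ℝ]^3 (TangentSpace 𝓘(ℝ, E3) p)}

theorem chartCoeff_ne_zero {q p : P} (hp : p ∈ (chartAt E3 q).source) (hχ : χ p ≠ 0) :
    chartCoeff χ q p ≠ 0 := by
  refine coeff3_ne_zero fun h => hχ ?_
  have hinv : (mfderiv 𝓘(ℝ, E3) 𝓘(ℝ, E3) (extChartAt 𝓘(ℝ, E3) q) p).IsInvertible :=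
    isInvertible_mfderiv_extChartAt (by simpa using hp)
  obtain ⟨e, he⟩ := hinv
  have hinj := exteriorPower.map_injective_field (n := 3)
    (f := (mfderiv 𝓘(ℝ, E3) 𝓘(ℝ, E3) (extChartAt 𝓘(ℝ, E3) q) p).toLinearMap)
    (by rw [← he]; exact e.injective)
  exact hinj (h.trans (map_zero _).symm)

theorem analyticOnNhd_chartCoeff (hχ : IsAnalyticSection χ) (q : P) :
    AnalyticOnNhd ℝ (fun x => chartCoeff χ q ((extChartAt 𝓘(ℝ, E3) q).symm x))
      (extChartAt 𝓘(ℝ, E3) q).target := by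
  have ho := isOpen_extChartAt_target (I := 𝓘(ℝ, E3)) q
  rw [← ho.analyticOn_iff_analyticOnNhd, ← contDiffOn_omega_iff_analyticOn ho.uniqueDiffOn,
    ← contMDiffOn_iff_contDiffOn]
  exact (hχ q).comp (contMDiffOn_extChartAt_symm q) fun x hx => by
    simpa using (extChartAt 𝓘(ℝ, E3) q).map_target hx

/-- The chain rule for `f = (f ∘ φ⁻¹) ∘ φ`, where `φ` is a chart. -/
theorem mfderiv_eq_fderiv_comp_mfderiv_extChartAt {f : P → E8} {q p : P}
    (hp : p ∈ (chartAt E3 q).source) (hf : MDifferentiableAt 𝓘(ℝ, E3) 𝓘(ℝ, E8) f p) :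
    mfderiv 𝓘(ℝ, E3) 𝓘(ℝ, E8) f p =
      (fderiv ℝ (f ∘ (extChartAt 𝓘(ℝ, E3) q).symm) (extChartAt 𝓘(ℝ, E3) q p) : E3 →L[ℝ] E8).comp
        (mfderiv 𝓘(ℝ, E3) 𝓘(ℝ, E3) (extChartAt 𝓘(ℝ, E3) q) p :
          TangentSpace 𝓘(ℝ, E3) p →L[ℝ] E3) := by
  have hps : p ∈ (extChartAt 𝓘(ℝ, E3) q).source := by simpa using hp
  have hinv := (extChartAt 𝓘(ℝ, E3) q).left_inv hps
  have hsymm : MDifferentiableAt 𝓘(ℝ, E3) 𝓘(ℝ, E3) (extChartAt 𝓘(ℝ, E3) q).symm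
      (extChartAt 𝓘(ℝ, E3) q p) :=
    (mdifferentiableOn_extChartAt_symm _ ((extChartAt 𝓘(ℝ, E3) q).map_source hps)).mdifferentiableAt
      ((isOpen_extChartAt_target q).mem_nhds ((extChartAt 𝓘(ℝ, E3) q).map_source hps))
  have hcomp : MDifferentiableAt 𝓘(ℝ, E3) 𝓘(ℝ, E8) (f ∘ (extChartAt 𝓘(ℝ, E3) q).symm)
      (extChartAt 𝓘(ℝ, E3) q p) := by
    refine MDifferentiableAt.comp _ (I' := 𝓘(ℝ, E3)) ?_ hsymm
    rwa [hinv]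
  rw [← mfderiv_eq_fderiv]
  have hev : f =ᶠ[𝓝 p] (f ∘ (extChartAt 𝓘(ℝ, E3) q).symm) ∘ extChartAt 𝓘(ℝ, E3) q := by
    filter_upwards [(isOpen_extChartAt_source (I := 𝓘(ℝ, E3)) q).mem_nhds hps] with y hy
    simp only [Function.comp_apply, (extChartAt 𝓘(ℝ, E3) q).left_inv hy]
  exact hev.mfderiv_eq.trans (mfderiv_comp p hcomp (mdifferentiableAt_extChartAt hp))

/-- The right-hand side of the evolution equation in coordinates. -/
theorem contractPhi0_pushforward3 {f : P → E8} {q p : P} (hp : p ∈ (chartAt E3 q).source)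
    (hf : MDifferentiableAt 𝓘(ℝ, E3) 𝓘(ℝ, E8) f p) {D : E3 →L[ℝ] E8}
    (hD : fderiv ℝ (f ∘ (extChartAt 𝓘(ℝ, E3) q).symm) (extChartAt 𝓘(ℝ, E3) q p) = D) :
    contractPhi0 (pushforward3 f p (χ p)) =
      chartCoeff χ q p • crossOuter (crossInner D D) D := by
  rw [crossOuter_crossInner, pushforward3, mfderiv_eq_fderiv_comp_mfderiv_extChartAt hp hf, hD]
  have h := exteriorPower.map_comp (n := 3)
    (mfderiv 𝓘(ℝ, E3) 𝓘(ℝ, E3) (extChartAt 𝓘(ℝ, E3) q) p :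
      TangentSpace 𝓘(ℝ, E3) p →L[ℝ] E3).toLinearMap D.toLinearMap
  have h' := congrArg (fun f => f (χ p)) h
  refine (congrArg contractPhi0 h').trans ?_
  exact contractPhi0_map _ _

end ChartCoefficient

/-! ### Local solutions on the manifold and their gluing -/

section LocalSolutions

theorem hasDerivAt_timeDeriv {E F : Type*} [NormedAddCommGroup E] [NormedSpace ℝ E]
    [NormedAddCommGroup F] [NormedSpace ℝ F] {g : ℝ × E → F} {t : ℝ} {x : E}
    (hg : DifferentiableAt ℝ g (t, x)) :
    HasDerivAt (fun s => g (s, x)) (timeDeriv g (t, x)) t :=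
  hg.hasFDerivAt.comp_hasDerivAt t ((hasDerivAt_id t).prodMk (hasDerivAt_const t x))

theorem hasFDerivAt_spaceDeriv {E F : Type*} [NormedAddCommGroup E] [NormedSpace ℝ E]
    [NormedAddCommGroup F] [NormedSpace ℝ F] {g : ℝ × E → F} {t : ℝ} {x : E}
    (hg : DifferentiableAt ℝ g (t, x)) :
    HasFDerivAt (fun y => g (t, y)) (spaceDeriv g (t, x)) x :=
  hg.hasFDerivAt.comp x ((hasFDerivAt_const t x).prodMk (hasFDerivAt_id x))

variable {P : Type*} [TopologicalSpace P] [ChartedSpace E3 P]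

/-- The maps `ψ t`, `|t| < ε`, form a real analytic solution of the evolution equation over the
subset `V` of `P`. -/
structure IsSolutionOn (χ : (p : P) → ⋀[ℝ]^3 (TangentSpace 𝓘(ℝ, E3) p)) (ε : ℝ) (V : Set P)
    (ψ : ℝ → P → E8) : Prop where
  analytic : ContMDiffOn (𝓘(ℝ, ℝ).prod 𝓘(ℝ, E3)) 𝓘(ℝ, E8) ω
    (fun x : ℝ × P => ψ x.1 x.2) (Ioo (-ε) ε ×ˢ V)
  evolution : ∀ t ∈ Ioo (-ε) ε, ∀ p ∈ V,
    HasDerivAt (fun s => ψ s p) (contractPhi0 (pushforward3 (ψ t) p (χ p))) t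

variable {χ : (p : P) → ⋀[ℝ]^3 (TangentSpace 𝓘(ℝ, E3) p)} {ε ε' : ℝ} {V V' : Set P}
  {ψ ψ' : ℝ → P → E8}

theorem isCayleyEvolution_iff {ψ₀ : P → E8} :
    IsCayleyEvolution χ ψ₀ ε ψ ↔ ψ 0 = ψ₀ ∧ IsSolutionOn χ ε univ ψ :=
  ⟨fun h => ⟨h.initial, h.analytic, fun t ht p _ => h.evolution t ht p⟩,
    fun h => ⟨h.2.analytic, h.1, fun t ht p => h.2.evolution t ht p (mem_univ p)⟩⟩

theorem IsSolutionOn.mono (h : IsSolutionOn χ ε V ψ) (hε : ε' ≤ ε) (hV : V' ⊆ V) :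
    IsSolutionOn χ ε' V' ψ := by
  have hI : Ioo (-ε') ε' ⊆ Ioo (-ε) ε := Ioo_subset_Ioo (neg_le_neg hε) hε
  exact ⟨h.analytic.mono (prod_mono hI hV), fun t ht p hp => h.evolution t (hI ht) p (hV hp)⟩

theorem IsSolutionOn.congr (h : IsSolutionOn χ ε V ψ) (hV : IsOpen V)
    (hψ : ∀ t ∈ Ioo (-ε) ε, ∀ p ∈ V, ψ' t p = ψ t p) : IsSolutionOn χ ε V ψ' := by
  refine ⟨h.analytic.congr fun x hx => hψ x.1 hx.1 x.2 hx.2, fun t ht p hp => ?_⟩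
  have h1 : ψ' t =ᶠ[𝓝 p] ψ t := by
    filter_upwards [hV.mem_nhds hp] with y hy using hψ t ht y hy
  have h2 : (fun s => ψ' s p) =ᶠ[𝓝 t] fun s => ψ s p := by
    filter_upwards [isOpen_Ioo.mem_nhds ht] with s hs using hψ s hs p hp
  have h3 : pushforward3 (ψ' t) p (χ p) = pushforward3 (ψ t) p (χ p) := by
    unfold pushforward3
    rw [h1.mfderiv_eq]
    rfl
  rw [h3]
  exact (h.evolution t ht p hp).congr_of_eventuallyEq h2

theorem isSolutionOn_of_locally
    (h : ∀ p ∈ V, ∃ W, IsOpen W ∧ p ∈ W ∧ IsSolutionOn χ ε W ψ) : IsSolutionOn χ ε V ψ := by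
  constructor
  · refine contMDiffOn_of_locally_contMDiffOn fun x hx => ?_
    obtain ⟨W, hW, hxW, hs⟩ := h x.2 hx.2
    exact ⟨univ ×ˢ W, isOpen_univ.prod hW, ⟨mem_univ _, hxW⟩,
      hs.analytic.mono fun y hy => ⟨hy.1.1, hy.2.2⟩⟩
  · intro t ht p hp
    obtain ⟨W, -, hpW, hs⟩ := h p hp
    exact hs.evolution t ht p hpW

theorem IsSolutionOn.contMDiffOn_slice (h : IsSolutionOn χ ε V ψ) {t : ℝ} (ht : t ∈ Ioo (-ε) ε) :
    ContMDiffOn 𝓘(ℝ, E3) 𝓘(ℝ, E8) ω (ψ t) V :=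
  h.analytic.comp (contMDiffOn_const.prodMk contMDiffOn_id) fun _ hp => ⟨ht, hp⟩

theorem IsSolutionOn.mdifferentiableAt (h : IsSolutionOn χ ε V ψ) (hV : IsOpen V) {t : ℝ}
    (ht : t ∈ Ioo (-ε) ε) {p : P} (hp : p ∈ V) :
    MDifferentiableAt 𝓘(ℝ, E3) 𝓘(ℝ, E8) (ψ t) p :=
  ((h.contMDiffOn_slice ht).contMDiffAt (hV.mem_nhds hp)).mdifferentiableAt (by simp)

/-- The coordinate representation of a map `ℝ × P → ℝ⁸` in the preferred chart at `q`. -/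
noncomputable def inChart (ψ : ℝ → P → E8) (q : P) (z : ℝ × E3) : E8 :=
  ψ z.1 ((extChartAt 𝓘(ℝ, E3) q).symm z.2)

theorem isOpen_extChartAt_target_inter_preimage (q : P) (hV : IsOpen V) :
    IsOpen ((extChartAt 𝓘(ℝ, E3) q).target ∩ (extChartAt 𝓘(ℝ, E3) q).symm ⁻¹' V) :=
  (continuousOn_extChartAt_symm q).isOpen_inter_preimage (isOpen_extChartAt_target q) hV

variable [IsManifold 𝓘(ℝ, E3) ω P]

theorem IsSolutionOn.analyticOnNhd_inChart (h : IsSolutionOn χ ε V ψ) (hV : IsOpen V) (q : P) :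
    AnalyticOnNhd ℝ (inChart ψ q) (Ioo (-ε) ε ×ˢ
      ((extChartAt 𝓘(ℝ, E3) q).target ∩ (extChartAt 𝓘(ℝ, E3) q).symm ⁻¹' V)) := by
  have ho : IsOpen (Ioo (-ε) ε ×ˢ ((extChartAt 𝓘(ℝ, E3) q).target ∩
      (extChartAt 𝓘(ℝ, E3) q).symm ⁻¹' V)) :=
    isOpen_Ioo.prod (isOpen_extChartAt_target_inter_preimage q hV)
  rw [← ho.analyticOn_iff_analyticOnNhd, ← contDiffOn_omega_iff_analyticOn ho.uniqueDiffOn,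
    ← contMDiffOn_iff_contDiffOn]
  refine h.analytic.comp (f := fun z : ℝ × E3 => (z.1, (extChartAt 𝓘(ℝ, E3) q).symm z.2))
    (ContMDiffOn.prodMk contDiff_fst.contMDiff.contMDiffOn ?_) fun z hz => ⟨hz.1, hz.2.2⟩
  exact (contMDiffOn_extChartAt_symm q).comp contDiff_snd.contMDiff.contMDiffOn
    fun z hz => hz.2.1

/-- In a chart, the evolution equation is a cubic first-order equation of Cauchy–Kovalevskaya
type. -/
theorem IsSolutionOn.timeDeriv_inChart (h : IsSolutionOn χ ε V ψ) (hV : IsOpen V) (q : P)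
    {z : ℝ × E3} (hz : z ∈ Ioo (-ε) ε ×ˢ
      ((extChartAt 𝓘(ℝ, E3) q).target ∩ (extChartAt 𝓘(ℝ, E3) q).symm ⁻¹' V)) :
    timeDeriv (inChart ψ q) z = chartCoeff χ q ((extChartAt 𝓘(ℝ, E3) q).symm z.2) •
      crossOuter (crossInner (spaceDeriv (inChart ψ q) z) (spaceDeriv (inChart ψ q) z))
        (spaceDeriv (inChart ψ q) z) := by
  obtain ⟨t, x⟩ := z
  have hd := (h.analyticOnNhd_inChart hV q (t, x) hz).differentiableAt
  have hp : (extChartAt 𝓘(ℝ, E3) q).symm x ∈ (chartAt E3 q).source := by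
    simpa using (extChartAt 𝓘(ℝ, E3) q).map_target hz.2.1
  refine (hasDerivAt_timeDeriv hd).unique ?_
  rw [← contractPhi0_pushforward3 hp (h.mdifferentiableAt hV hz.1 hz.2.2)]
  · exact h.evolution t hz.1 _ hz.2.2
  · rw [(extChartAt 𝓘(ℝ, E3) q).right_inv hz.2.1]
    exact (hasFDerivAt_spaceDeriv hd).fderiv

/-- Solutions of the evolution equation with the same initial values agree. -/
theorem IsSolutionOn.eqOn (h : IsSolutionOn χ ε V ψ) (h' : IsSolutionOn χ ε V ψ')
    (hε : 0 < ε) (hV : IsOpen V) (h0 : ∀ p ∈ V, ψ 0 p = ψ' 0 p) {t : ℝ} (ht : t ∈ Ioo (-ε) ε)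
    {p : P} (hp : p ∈ V) : ψ t p = ψ' t p := by
  have hps : p ∈ (extChartAt 𝓘(ℝ, E3) p).source := mem_extChartAt_source p
  have hinv := (extChartAt 𝓘(ℝ, E3) p).left_inv hps
  have key := eqOn_of_cauchyKovalevskaya hε (isOpen_extChartAt_target_inter_preimage p hV)
    (h.analyticOnNhd_inChart hV p) (h'.analyticOnNhd_inChart hV p)
    (c := fun x => chartCoeff χ p ((extChartAt 𝓘(ℝ, E3) p).symm x))
    (fun z hz => h.timeDeriv_inChart hV p hz) (fun z hz => h'.timeDeriv_inChart hV p hz)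
    (fun x hx => h0 _ hx.2)
  have hz : (t, extChartAt 𝓘(ℝ, E3) p p) ∈ Ioo (-ε) ε ×ˢ
      ((extChartAt 𝓘(ℝ, E3) p).target ∩ (extChartAt 𝓘(ℝ, E3) p).symm ⁻¹' V) :=
    ⟨ht, (extChartAt 𝓘(ℝ, E3) p).map_source hps, by rwa [mem_preimage, hinv]⟩
  simpa only [inChart, hinv] using key hz

/-- A solution in coordinates defines a solution on `P`. -/
theorem isSolutionOn_of_inChart {q : P} {a : ℝ × E3 → E8}
    (hVs : V ⊆ (extChartAt 𝓘(ℝ, E3) q).source) {Ω : Set (ℝ × E3)}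
    (hΩ : ∀ t ∈ Ioo (-ε) ε, ∀ p ∈ V, (t, extChartAt 𝓘(ℝ, E3) q p) ∈ Ω)
    (ha : AnalyticOnNhd ℝ a Ω)
    (ha' : ∀ z ∈ Ω, timeDeriv a z = chartCoeff χ q ((extChartAt 𝓘(ℝ, E3) q).symm z.2) •
      crossOuter (crossInner (spaceDeriv a z) (spaceDeriv a z)) (spaceDeriv a z)) :
    IsSolutionOn χ ε V fun t p => a (t, extChartAt 𝓘(ℝ, E3) q p) := by
  have hsrc : V ⊆ (chartAt E3 q).source := by simpa using hVs
  have hcont : ∀ t ∈ Ioo (-ε) ε, ∀ p ∈ V, ContMDiffAt (𝓘(ℝ, ℝ).prod 𝓘(ℝ, E3)) 𝓘(ℝ, E8) ω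
      (fun x : ℝ × P => a (x.1, extChartAt 𝓘(ℝ, E3) q x.2)) (t, p) := fun t ht p hp => by
    have h1 : ContMDiffAt 𝓘(ℝ, ℝ × E3) 𝓘(ℝ, E8) ω a (t, extChartAt 𝓘(ℝ, E3) q p) :=
      (ha _ (hΩ t ht p hp)).contDiffAt.contMDiffAt
    have h2 : ContMDiffAt (𝓘(ℝ, ℝ).prod 𝓘(ℝ, E3)) 𝓘(ℝ, ℝ × E3) ω
        (fun x : ℝ × P => (x.1, extChartAt 𝓘(ℝ, E3) q x.2)) (t, p) := by
      refine ContMDiffAt.prodMk_space contMDiffAt_fst ?_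
      exact ((contMDiffOn_extChartAt (x := q)).contMDiffAt
        ((chartAt E3 q).open_source.mem_nhds (hsrc hp))).comp (t, p) contMDiffAt_snd
    exact ContMDiffAt.comp (t, p) h1 h2
  refine ⟨fun x hx => (hcont x.1 hx.1 x.2 hx.2).contMDiffWithinAt, fun t ht p hp => ?_⟩
  have hd := (ha _ (hΩ t ht p hp)).differentiableAt
  have hf : MDifferentiableAt 𝓘(ℝ, E3) 𝓘(ℝ, E8)
      (fun p => a (t, extChartAt 𝓘(ℝ, E3) q p)) p :=
    (ContMDiffAt.comp (f := fun p : P => (t, p)) p (hcont t ht p hp)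
        (contMDiffAt_const.prodMk contMDiffAt_id) :
      ContMDiffAt 𝓘(ℝ, E3) 𝓘(ℝ, E8) ω (fun p => a (t, extChartAt 𝓘(ℝ, E3) q p)) p)
        |>.mdifferentiableAt (by simp)
  have hD : fderiv ℝ ((fun p => a (t, extChartAt 𝓘(ℝ, E3) q p)) ∘ (extChartAt 𝓘(ℝ, E3) q).symm)
      (extChartAt 𝓘(ℝ, E3) q p) = spaceDeriv a (t, extChartAt 𝓘(ℝ, E3) q p) := by
    rw [← (hasFDerivAt_spaceDeriv hd).fderiv]
    refine Filter.EventuallyEq.fderiv_eq ?_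
    filter_upwards [(isOpen_extChartAt_target q).mem_nhds
      ((extChartAt 𝓘(ℝ, E3) q).map_source (hVs hp))] with x hx
    simp only [Function.comp_apply, (extChartAt 𝓘(ℝ, E3) q).right_inv hx]
  rw [contractPhi0_pushforward3 (hsrc hp) hf hD]
  have h1 := ha' _ (hΩ t ht p hp)
  simp only [(extChartAt 𝓘(ℝ, E3) q).left_inv (hVs hp)] at h1
  rw [← h1]
  exact hasDerivAt_timeDeriv hd

theorem exists_isSolutionOn_nhds (hχ : IsAnalyticSection χ) {ψ₀ : P → E8}
    (hψ₀ : ContMDiff 𝓘(ℝ, E3) 𝓘(ℝ, E8) ω ψ₀) (q : P) :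
    ∃ ε > 0, ∃ V, IsOpen V ∧ q ∈ V ∧ ∃ ψ, IsSolutionOn χ ε V ψ ∧ ∀ p ∈ V, ψ 0 p = ψ₀ p := by
  set φ := extChartAt 𝓘(ℝ, E3) q with hφ
  have hqs : q ∈ φ.source := mem_extChartAt_source q
  have ho : IsOpen φ.target := isOpen_extChartAt_target q
  have hu : AnalyticAt ℝ (ψ₀ ∘ φ.symm) (φ q) := by
    have h1 : AnalyticOnNhd ℝ (ψ₀ ∘ φ.symm) φ.target := by
      rw [← ho.analyticOn_iff_analyticOnNhd, ← contDiffOn_omega_iff_analyticOn ho.uniqueDiffOn,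
        ← contMDiffOn_iff_contDiffOn]
      exact hψ₀.comp_contMDiffOn (contMDiffOn_extChartAt_symm q)
    exact h1 _ (φ.map_source hqs)
  obtain ⟨r, hr, U, hU, hU0, hUt⟩ := exists_cauchyKovalevskaya crossInner crossOuter
    (analyticOnNhd_chartCoeff hχ q _ (φ.map_source hqs)) hu
  have hr' : (0 : ℝ) < r := hr
  have hball : (Metric.eball (0, φ q) r : Set (ℝ × E3)) =
      Ioo (-(r : ℝ)) r ×ˢ Metric.ball (φ q) r := by
    rw [Metric.eball_coe, ← ball_prod_same, Real.ball_eq_Ioo, zero_sub, zero_add]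
  have hV : IsOpen (φ.source ∩ φ ⁻¹' Metric.ball (φ q) r) :=
    (continuousOn_extChartAt q).isOpen_inter_preimage (isOpen_extChartAt_source q)
      Metric.isOpen_ball
  refine ⟨r, hr', φ.source ∩ φ ⁻¹' Metric.ball (φ q) r, hV, ⟨hqs, by simpa using hr'⟩,
    fun t p => U (t, φ p), ?_, fun p hp => ?_⟩
  · refine isSolutionOn_of_inChart inter_subset_left (fun t ht p hp => ?_) hU hUt
    rw [hball]
    exact ⟨ht, hp.2⟩
  · change U (0, φ p) = ψ₀ p
    rw [hU0, Function.comp_apply, φ.left_inv hp.1]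

/-- Local solutions over a finite cover of `P` agree on the overlaps, hence they glue. -/
theorem exists_isCayleyEvolution [CompactSpace P] (hχ : IsAnalyticSection χ) {ψ₀ : P → E8}
    (hψ₀ : ContMDiff 𝓘(ℝ, E3) 𝓘(ℝ, E8) ω ψ₀) :
    ∃ ε > 0, ∃ ψ : ℝ → P → E8, IsCayleyEvolution χ ψ₀ ε ψ := by
  choose ε hε V hV hmem ψ hψ hψ0 using exists_isSolutionOn_nhds hχ hψ₀
  obtain ⟨s, hs⟩ := isCompact_univ.elim_nhds_subcover V fun q _ => (hV q).mem_nhds (hmem q)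
  have hcov : ∀ p : P, ∃ q ∈ s, p ∈ V q := fun p => by simpa using hs.2 (mem_univ p)
  choose i his hi using hcov
  obtain ⟨δ, hδ, hδs⟩ : ∃ δ > 0, ∀ q ∈ s, δ ≤ ε q := by
    rcases s.eq_empty_or_nonempty with rfl | hne
    · exact ⟨1, one_pos, by simp⟩
    · obtain ⟨q, -, hq⟩ := s.exists_min_image ε hne
      exact ⟨ε q, hε q, hq⟩
  refine ⟨δ, hδ, fun t p => ψ (i p) t p, isCayleyEvolution_iff.2
    ⟨funext fun p => hψ0 _ p (hi p), isSolutionOn_of_locally fun p _ =>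
      ⟨V (i p), hV _, hi p, ?_⟩⟩⟩
  refine ((hψ (i p)).mono (hδs _ (his p)) Subset.rfl).congr (hV _) fun t ht y hy => ?_
  refine IsSolutionOn.eqOn ((hψ (i y)).mono (hδs _ (his y)) inter_subset_left)
    ((hψ (i p)).mono (hδs _ (his p)) inter_subset_right) hδ ((hV (i y)).inter (hV (i p)))
    (fun x hx => ?_) ht ⟨hi y, hy⟩
  rw [hψ0 _ x hx.1, hψ0 _ x hx.2]

theorem IsCayleyEvolution.eq {ψ₀ : P → E8} (h : IsCayleyEvolution χ ψ₀ ε ψ)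
    (h' : IsCayleyEvolution χ ψ₀ ε ψ') (hε : 0 < ε) {t : ℝ} (ht : t ∈ Ioo (-ε) ε) : ψ' t = ψ t := by
  rw [isCayleyEvolution_iff] at h h'
  exact funext fun p => h'.2.eqOn h.2 hε isOpen_univ (fun p _ => by rw [h.1, h'.1]) ht (mem_univ p)

end LocalSolutions

/-! ### The orientation defined by the pull-back of `Φ₀` -/

section PullbackOrientation

variable {E H N : Type*} [NormedAddCommGroup E] [NormedSpace ℝ E] [TopologicalSpace H]
  [TopologicalSpace N] [ChartedSpace H N] {I : ModelWithCorners ℝ E H}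

/-- The pull-back `F^*Φ₀` at the point `x`. -/
noncomputable def pullbackPhi0 (I : ModelWithCorners ℝ E H) (F : N → E8) (x : N) :
    TangentSpace I x [⋀^Fin 4]→ₗ[ℝ] ℝ :=
  Phi0.compLinearMap (M := E8) (M₂ := TangentSpace I x) (mfderiv I 𝓘(ℝ, E8) F x).toLinearMap

/-- A basis of the tangent space of a 4-manifold at `x`, with no compatibility between different
points. -/
noncomputable def tangentBasis (I : ModelWithCorners ℝ E H) (hE : Module.finrank ℝ E = 4) (x : N) :
    Module.Basis (Fin 4) ℝ (TangentSpace I x) :=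
  haveI : Module.Finite ℝ E := Module.finite_of_finrank_eq_succ hE
  (Module.finBasisOfFinrankEq ℝ E hE :)

/-- The orientation of the tangent spaces of `N` for which `F^*Φ₀` is positive, at the points
where `F^*Φ₀ ≠ 0`. Elsewhere it is the orientation of some basis. -/
noncomputable def pullbackOrientation (I : ModelWithCorners ℝ E H)
    (hE : Module.finrank ℝ E = 4) (F : N → E8) (x : N) :
    Orientation ℝ (TangentSpace I x) (Fin 4) :=
  open scoped Classical in
  if h : pullbackPhi0 I F x ≠ 0 then rayOfNeZero ℝ (pullbackPhi0 I F x) h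
  else (tangentBasis I hE x).orientation

theorem orientation_eq_pullbackOrientation_iff {hE : Module.finrank ℝ E = 4} {F : N → E8} {x : N}
    (h : pullbackPhi0 I F x ≠ 0) (b : Module.Basis (Fin 4) ℝ (TangentSpace I x)) :
    b.orientation = pullbackOrientation I hE F x ↔ 0 < pullbackPhi0 I F x b := by
  have hb := (pullbackPhi0 I F x).eq_smul_basis_det b
  have hne : pullbackPhi0 I F x b ≠ 0 := fun h0 => h (by rw [hb, h0, zero_smul])
  rw [pullbackOrientation, dif_pos h, Module.Basis.orientation, ray_eq_iff]
  conv_lhs => rw [hb]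
  exact sameRay_smul_right_iff_of_ne b.det_ne_zero hne

theorem continuousOn_mfderiv_apply [IsManifold I 1 N] {F : N → E8} {U : Set N} (hU : IsOpen U)
    (hF : ContMDiffOn I 𝓘(ℝ, E8) 1 F U) {X : (x : N) → TangentSpace I x}
    (hX : ContinuousOn (fun x => (⟨x, X x⟩ : TangentBundle I N)) U) :
    ContinuousOn (fun x => (mfderiv I 𝓘(ℝ, E8) F x (X x) : E8)) U := by
  have h1 := hF.continuousOn_tangentMapWithin le_rfl hU.uniqueMDiffOn
  have h2 := h1.comp hX fun x hx => hx
  have h3 : Continuous fun y : TangentBundle 𝓘(ℝ, E8) E8 => (y.2 : E8) :=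
    continuous_snd.comp (tangentBundleModelSpaceHomeomorph 𝓘(ℝ, E8)).continuous
  refine ContinuousOn.congr (h3.comp_continuousOn h2) fun x hx => ?_
  have h4 := tangentMapWithin_eq_tangentMap (I := I) (I' := 𝓘(ℝ, E8)) (p := ⟨x, X x⟩)
    (hU.uniqueMDiffOn x hx) ((hF.contMDiffAt (hU.mem_nhds hx)).mdifferentiableAt one_ne_zero)
  exact (congrArg (fun y : TangentBundle 𝓘(ℝ, E8) E8 => (y.2 : E8)) h4).symm

theorem continuous_Phi0 : Continuous fun v : Fin 4 → E8 => Phi0 v := by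
  have h : ∀ i j k l, Continuous fun v : Fin 4 → E8 => dx4 i j k l v := fun i j k l => by
    simp_rw [dx4_apply]
    refine Continuous.matrix_det (continuous_matrix fun a b => ?_)
    exact (EuclideanSpace.proj (𝕜 := ℝ) (![i, j, k, l] b)).continuous.comp (continuous_apply a)
  simp only [Phi0, AlternatingMap.add_apply, AlternatingMap.sub_apply]
  fun_prop (disch := exact h _ _ _ _)

/-- A basis at `x₀` that is positive for `F^*Φ₀` extends to a continuous local frame, which remains
positive near `x₀`. -/
theorem isOrientationOn_pullbackOrientation [IsManifold I 1 N] (hE : Module.finrank ℝ E = 4)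
    {F : N → E8} {U : Set N} (hU : IsOpen U) (hF : ContMDiffOn I 𝓘(ℝ, E8) 1 F U)
    (h : ∀ x ∈ U, pullbackPhi0 I F x ≠ 0) :
    IsOrientationOn I U (pullbackOrientation I hE F) := by
  intro x₀ hx₀
  set e := trivializationAt E (TangentSpace I) x₀ with he
  have hxe : x₀ ∈ e.baseSet := FiberBundle.mem_baseSet_trivializationAt' x₀
  obtain ⟨β₀, hβ₀⟩ : ∃ β₀ : Module.Basis (Fin 4) ℝ (TangentSpace I x₀),
      0 < pullbackPhi0 I F x₀ β₀ :=
    ⟨(tangentBasis I hE x₀).adjustToOrientation (pullbackOrientation I hE F x₀),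
      (orientation_eq_pullbackOrientation_iff (hE := hE) (h x₀ hx₀) _).1
        (Module.Basis.orientation_adjustToOrientation _ _)⟩
  let β : Module.Basis (Fin 4) ℝ E := β₀.map (e.linearEquivAt ℝ x₀ hxe)
  have hβ : e.basisAt β hxe = β₀ := by
    ext i
    exact (e.linearEquivAt ℝ x₀ hxe).symm_apply_apply (β₀ i)
  classical
  let b : (x : N) → Module.Basis (Fin 4) ℝ (TangentSpace I x) := fun x =>
    if hx : x ∈ e.baseSet then e.basisAt β hx
    else tangentBasis I hE x
  have hb : ∀ x (hx : x ∈ e.baseSet) i, e.localFrame β i x = b x i := fun x hx i => by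
    rw [Bundle.Trivialization.localFrame_apply_of_mem_baseSet _ _ hx]
    simp only [b, dif_pos hx]
  have hcont : ∀ i, ContinuousOn (fun x => (⟨x, b x i⟩ : TangentBundle I N)) e.baseSet :=
    fun i => by
      have := (e.contMDiffOn_localFrame_baseSet (I := I) 0 β i).continuousOn
      refine this.congr fun x hx => ?_
      simp only [hb x hx i]
  have hUe : IsOpen (U ∩ e.baseSet) := hU.inter e.open_baseSet
  have hΦ : ContinuousOn (fun x => pullbackPhi0 I F x (b x)) (U ∩ e.baseSet) :=
    continuous_Phi0.comp_continuousOn (continuousOn_pi.2 fun i =>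
      continuousOn_mfderiv_apply hUe (hF.mono inter_subset_left)
        ((hcont i).mono inter_subset_right))
  refine ⟨(U ∩ e.baseSet) ∩ (fun x => pullbackPhi0 I F x (b x)) ⁻¹' Ioi 0,
    (hΦ.isOpen_inter_preimage hUe isOpen_Ioi).mem_nhds ⟨⟨hx₀, hxe⟩, ?_⟩, b,
    fun i => (hcont i).mono fun x hx => hx.1.2, fun x hx =>
      (orientation_eq_pullbackOrientation_iff (h x hx.1.1) _).2 hx.2⟩
  have : b x₀ = β₀ := by simp only [b, dif_pos hxe, hβ]
  simpa only [mem_preimage, mem_Ioi, this] using hβ₀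

end PullbackOrientation

/-! ### Tangent planes of the evolution -/

section CayleyPlanes

variable {A : E3 →ₗ[ℝ] E8} {c : ℝ} {L : ℝ × E3 →ₗ[ℝ] E8}

/-- The triple cross product of the images of the standard basis vectors under `A`. -/
noncomputable def frameCross (A : E3 →ₗ[ℝ] E8) : E8 :=
  tripleCross (A (EuclideanSpace.single 0 1)) (A (EuclideanSpace.single 1 1))
    (A (EuclideanSpace.single 2 1))

theorem frameCross_ne_zero (hA : Function.Injective A) : frameCross A ≠ 0 := by
  refine tripleCross_ne_zero ?_
  have h := (EuclideanSpace.basisFun (Fin 3) ℝ).toBasis.linearIndependent.map'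
    A (LinearMap.ker_eq_bot.2 hA)
  have h2 : A ∘ (EuclideanSpace.basisFun (Fin 3) ℝ).toBasis = ![A (EuclideanSpace.single 0 1),
      A (EuclideanSpace.single 1 1), A (EuclideanSpace.single 2 1)] := by
    funext i
    fin_cases i <;> simp
  exact h2 ▸ h

theorem inner_frameCross (A : E3 →ₗ[ℝ] E8) (v : E3) : inner ℝ (frameCross A) (A v) = 0 := by
  have h : ((innerSL ℝ (frameCross A)).toLinearMap ∘ₗ A) = 0 := by
    refine (EuclideanSpace.basisFun (Fin 3) ℝ).toBasis.ext fun i => ?_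
    simp only [OrthonormalBasis.coe_toBasis, EuclideanSpace.basisFun_apply, LinearMap.comp_apply,
      ContinuousLinearMap.coe_coe, innerSL_apply_apply, LinearMap.zero_apply]
    rw [frameCross, inner_tripleCross]
    fin_cases i
    · exact Phi0.map_eq_zero_of_eq _ (i := 0) (j := 3) rfl (by decide)
    · exact Phi0.map_eq_zero_of_eq _ (i := 1) (j := 3) rfl (by decide)
    · exact Phi0.map_eq_zero_of_eq _ (i := 2) (j := 3) rfl (by decide)
  exact congrArg (fun f => f v) h

theorem injective_of_eq_smul_frameCross_add (hA : Function.Injective A) (hc : c ≠ 0)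
    (hL : ∀ s v, L (s, v) = s • c • frameCross A + A v) : Function.Injective L := by
  rw [injective_iff_map_eq_zero]
  rintro ⟨s, v⟩ h
  rw [hL] at h
  have h1 := congrArg (fun y => inner ℝ (frameCross A) y) h
  simp only [inner_add_right, inner_smul_right, inner_frameCross, inner_zero_right, add_zero] at h1
  have hs : s = 0 := by
    simpa [hc, inner_self_eq_zero, frameCross_ne_zero hA] using h1
  rw [hs, zero_smul, zero_add] at h
  rw [hs, (map_eq_zero_iff A hA).1 h]
  rfl

/-- The basis `e₁, e₂, e₃, ∂ₜ` of `ℝ × ℝ³`. -/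
noncomputable def spaceTimeFrame : Fin 4 → ℝ × E3 :=
  ![(0, EuclideanSpace.single 0 1), (0, EuclideanSpace.single 1 1),
    (0, EuclideanSpace.single 2 1), (1, 0)]

theorem map_spaceTimeFrame_three (hL : ∀ s v, L (s, v) = s • c • frameCross A + A v) :
    L (spaceTimeFrame 3) = c • tripleCross (L (spaceTimeFrame 0)) (L (spaceTimeFrame 1))
      (L (spaceTimeFrame 2)) := by
  have h : ∀ v, L (0, v) = A v := fun v => by rw [hL, zero_smul, zero_add]
  change L (1, 0) = c • tripleCross (L (0, _)) (L (0, _)) (L (0, _))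
  rw [h, h, h, hL, one_smul, map_zero, add_zero, frameCross]

theorem Phi0_map_spaceTimeFrame_ne_zero (hA : Function.Injective A) (hc : c ≠ 0)
    (hL : ∀ s v, L (s, v) = s • c • frameCross A + A v) :
    Phi0 (fun i => L (spaceTimeFrame i)) ≠ 0 := by
  have h : (fun i => L (spaceTimeFrame i)) = ![A (EuclideanSpace.single 0 1),
      A (EuclideanSpace.single 1 1), A (EuclideanSpace.single 2 1), c • frameCross A] := by
    funext i
    fin_cases i <;> simp [spaceTimeFrame, hL]
  rw [h, frameCross, Phi0_tripleCross_smul]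
  exact mul_ne_zero hc (inner_self_ne_zero.2 (frameCross_ne_zero hA))

variable {P : Type*} [TopologicalSpace P] [ChartedSpace E3 P]
  {χ : (p : P) → ⋀[ℝ]^3 (TangentSpace 𝓘(ℝ, E3) p)} {ψ₀ : P → E8} {ε : ℝ} {ψ : ℝ → P → E8}

/-- The differential of `f : P → ℝ⁸` at `p`, as a linear map on the model space `ℝ³`, to which
the tangent space of `P` at `p` is equal by definition. -/
noncomputable def sliceDifferential (f : P → E8) (p : P) : E3 →ₗ[ℝ] E8 :=
  ContinuousLinearMap.toLinearMap (mfderiv 𝓘(ℝ, E3) 𝓘(ℝ, E8) f p : E3 →L[ℝ] E8)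

/-- The differential of `(t, p) ↦ ψ t p`, as a linear map on the model space `ℝ × ℝ³`. -/
noncomputable def spaceTimeDifferential (ψ : ℝ → P → E8) (x : ℝ × P) : ℝ × E3 →ₗ[ℝ] E8 :=
  ContinuousLinearMap.toLinearMap (mfderiv (𝓘(ℝ, ℝ).prod 𝓘(ℝ, E3)) 𝓘(ℝ, E8)
    (fun x : ℝ × P => ψ x.1 x.2) x : ℝ × E3 →L[ℝ] E8)

/-- For a solution, `∂ₜψ` is a non-zero multiple of the triple cross product of a basis of the
image of the space differential. -/
theorem IsCayleyEvolution.spaceTimeDifferential_apply (h : IsCayleyEvolution χ ψ₀ ε ψ) {t : ℝ}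
    (ht : t ∈ Ioo (-ε) ε) (p : P) (hχ : χ p ≠ 0) :
    ∃ c : ℝ, c ≠ 0 ∧ ∀ (s : ℝ) (v : E3), spaceTimeDifferential ψ (t, p) (s, v) =
      s • c • frameCross (sliceDifferential (ψ t) p) + sliceDifferential (ψ t) p v := by
  have hd : MDifferentiableAt (𝓘(ℝ, ℝ).prod 𝓘(ℝ, E3)) 𝓘(ℝ, E8)
      (fun x : ℝ × P => ψ x.1 x.2) (t, p) :=
    (h.analytic.contMDiffAt ((isOpen_Ioo.prod isOpen_univ).mem_nhds
      ⟨ht, mem_univ p⟩)).mdifferentiableAt (by simp)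
  refine ⟨coeff3 (show ⋀[ℝ]^3 E3 from χ p), coeff3_ne_zero hχ, fun s v => ?_⟩
  have h1 := mfderiv_prod_eq_add_apply (v := ((s, v) : ℝ × E3)) hd
  have h2 : (mfderiv 𝓘(ℝ, ℝ) 𝓘(ℝ, E8) (fun s => ψ s p) t : ℝ →L[ℝ] E8) s =
      s • contractPhi0 (pushforward3 (ψ t) p (χ p)) := by
    rw [mfderiv_eq_fderiv]
    exact congrArg (fun f : ℝ →L[ℝ] E8 => f s) (h.evolution t ht p).hasFDerivAt.fderiv
  refine h1.trans (congrArg (fun y : E8 => y + sliceDifferential (ψ t) p v)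
    (h2.trans (congrArg (s • ·) ?_)))
  exact contractPhi0_map (sliceDifferential (ψ t) p) (show ⋀[ℝ]^3 E3 from χ p)

theorem IsCayleyEvolution.isImmersedCayleyOn [IsManifold 𝓘(ℝ, E3) ω P]
    (h : IsCayleyEvolution χ ψ₀ ε ψ)
    (hχ : ∀ p, χ p ≠ 0) (hinj : ∀ t ∈ Ioo (-ε) ε, ∀ p,
      Function.Injective (mfderiv 𝓘(ℝ, E3) 𝓘(ℝ, E8) (ψ t) p)) :
    IsImmersedCayleyOn (𝓘(ℝ, ℝ).prod 𝓘(ℝ, E3)) (fun x : ℝ × P => ψ x.1 x.2)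
      (Ioo (-ε) ε ×ˢ univ) := by
  have hE : Module.finrank ℝ (ℝ × E3) = 4 := by simp
  have hU : IsOpen (Ioo (-ε) ε ×ˢ (univ : Set P)) := isOpen_Ioo.prod isOpen_univ
  have hne : ∀ x ∈ Ioo (-ε) ε ×ˢ (univ : Set P), pullbackPhi0 (𝓘(ℝ, ℝ).prod 𝓘(ℝ, E3))
      (fun x : ℝ × P => ψ x.1 x.2) x ≠ 0 := by
    rintro ⟨t, p⟩ hx h0
    obtain ⟨c, hc, hL⟩ := h.spaceTimeDifferential_apply hx.1 p (hχ p)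
    exact Phi0_map_spaceTimeFrame_ne_zero (hinj t hx.1 p) hc hL
      (congrArg (fun f => f spaceTimeFrame) h0)
  refine ⟨hU, hE, h.analytic.of_le (by simp), ?_, pullbackOrientation _ hE _,
    isOrientationOn_pullbackOrientation hE hU (h.analytic.of_le (by simp)) hne, ?_⟩
  · rintro ⟨t, p⟩ hx
    obtain ⟨c, hc, hL⟩ := h.spaceTimeDifferential_apply hx.1 p (hχ p)
    exact injective_of_eq_smul_frameCross_add (hinj t hx.1 p) hc hL
  · rintro ⟨t, p⟩ hx b hb v hv hort
    obtain ⟨c, hc, hL⟩ := h.spaceTimeDifferential_apply hx.1 p (hχ p)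
    have hpos := (orientation_eq_pullbackOrientation_iff (hE := hE) (hne _ hx) b).1 hb
    have hpos' : 0 < Phi0 v := by
      rw [show v = _ from funext hv]
      exact hpos
    rw [show v = _ from funext hv] at hort
    have hsq : Phi0 v ^ 2 = 1 := by
      rw [show v = _ from funext hv]
      exact Phi0_sq_eq_one_of_orthonormal (M := ℝ × E3) (spaceTimeDifferential ψ (t, p)) b hort
        (map_spaceTimeFrame_three hL) (Phi0_map_spaceTimeFrame_ne_zero (hinj t hx.1 p) hc hL)
    exact (pow_eq_one_iff_of_nonneg hpos'.le two_ne_zero).1 hsq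

end CayleyPlanes

/-! ### Immersions and embeddings for small times -/

section SmallTimes

/-- A map with injective strict derivative is locally injective. -/
theorem HasStrictFDerivAt.exists_injOn_of_injective {E F : Type*} [NormedAddCommGroup E]
    [NormedSpace ℝ E] [FiniteDimensional ℝ E] [NormedAddCommGroup F] [NormedSpace ℝ F]
    [FiniteDimensional ℝ F] {f : E → F} {f' : E →L[ℝ] F} {x : E} (hf : HasStrictFDerivAt f f' x)
    (hinj : Function.Injective f') : ∃ s ∈ 𝓝 x, InjOn f s := by
  obtain ⟨g, hg⟩ := LinearMap.exists_leftInverse_of_injective f'.toLinearMap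
    (LinearMap.ker_eq_bot.2 hinj)
  -- A linear left inverse of the derivative reduces this to the inverse function theorem.
  have h1 : HasStrictFDerivAt (g.toContinuousLinearMap ∘ f)
      ((ContinuousLinearEquiv.refl ℝ E : E ≃L[ℝ] E) : E →L[ℝ] E) x := by
    have h2 := g.toContinuousLinearMap.hasStrictFDerivAt.comp x hf
    have h3 : g.toContinuousLinearMap.comp f' =
        ((ContinuousLinearEquiv.refl ℝ E : E ≃L[ℝ] E) : E →L[ℝ] E) :=
      ContinuousLinearMap.ext fun v => congrArg (fun k => k v) hg
    rwa [h3] at h2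
  have : CompleteSpace E := FiniteDimensional.complete ℝ E
  refine ⟨(h1.toOpenPartialHomeomorph _).source,
    (h1.toOpenPartialHomeomorph _).open_source.mem_nhds h1.mem_toOpenPartialHomeomorph_source, ?_⟩
  have h4 := (h1.toOpenPartialHomeomorph _).injOn
  rw [h1.toOpenPartialHomeomorph_coe] at h4
  exact h4.of_comp

theorem exists_Ioo_subset_of_mem_nhds_zero {p : ℝ → Prop} (h : ∀ᶠ t in 𝓝 (0 : ℝ), p t) :
    ∃ δ > 0, ∀ t ∈ Ioo (-δ) δ, p t := by
  obtain ⟨δ, hδ, hs⟩ := Metric.eventually_nhds_iff_ball.1 h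
  refine ⟨δ, hδ, fun t ht => hs t ?_⟩
  rwa [Real.ball_eq_Ioo, zero_sub, zero_add]

variable {P : Type*} [TopologicalSpace P] [ChartedSpace E3 P]
  {χ : (p : P) → ⋀[ℝ]^3 (TangentSpace 𝓘(ℝ, E3) p)} {ψ₀ : P → E8} {ε ε' : ℝ} {ψ : ℝ → P → E8}

theorem IsCayleyEvolution.mono (h : IsCayleyEvolution χ ψ₀ ε ψ) (hε : ε' ≤ ε) :
    IsCayleyEvolution χ ψ₀ ε' ψ := by
  rw [isCayleyEvolution_iff] at h ⊢
  exact ⟨h.1, h.2.mono hε Subset.rfl⟩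

theorem IsCayleyEvolution.continuousOn (h : IsCayleyEvolution χ ψ₀ ε ψ) :
    ContinuousOn (fun x : ℝ × P => ψ x.1 x.2) (Ioo (-ε) ε ×ˢ univ) :=
  h.analytic.continuousOn

theorem IsCayleyEvolution.continuousAt (h : IsCayleyEvolution χ ψ₀ ε ψ) {t : ℝ}
    (ht : t ∈ Ioo (-ε) ε) (p : P) : ContinuousAt (fun x : ℝ × P => ψ x.1 x.2) (t, p) :=
  h.continuousOn.continuousAt ((isOpen_Ioo.prod isOpen_univ).mem_nhds ⟨ht, mem_univ p⟩)

/-- An injective evolution is an embedding on every smaller time interval, because a continuous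
injection of the compact set `[-ε', ε'] × P` is a closed embedding. -/
theorem IsCayleyEvolution.isEmbedding_domRestrict [CompactSpace P] (h : IsCayleyEvolution χ ψ₀ ε ψ)
    (hε : ε' < ε) (hinj : InjOn (fun x : ℝ × P => ψ x.1 x.2) (Ioo (-ε) ε ×ˢ univ)) :
    IsEmbedding ((Ioo (-ε') ε' ×ˢ (univ : Set P)).domRestrict fun x : ℝ × P => ψ x.1 x.2) := by
  set K : Set (ℝ × P) := Icc (-ε') ε' ×ˢ univ with hK
  have hKsub : K ⊆ Ioo (-ε) ε ×ˢ univ := prod_mono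
    (Icc_subset_Ioo (neg_lt_neg hε) hε) Subset.rfl
  have : CompactSpace K := isCompact_iff_compactSpace.1 (isCompact_Icc.prod isCompact_univ)
  have h1 : IsClosedEmbedding (K.domRestrict fun x : ℝ × P => ψ x.1 x.2) :=
    Continuous.isClosedEmbedding (h.continuousOn.mono hKsub).domRestrict
      (injOn_iff_injective.1 (hinj.mono hKsub))
  exact h1.isEmbedding.comp
    (IsEmbedding.inclusion (Set.prod_mono Ioo_subset_Icc_self Subset.rfl))

variable [IsManifold 𝓘(ℝ, E3) ω P]

theorem IsCayleyEvolution.analyticOnNhd_inChart (h : IsCayleyEvolution χ ψ₀ ε ψ) (q : P) :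
    AnalyticOnNhd ℝ (inChart ψ q) (Ioo (-ε) ε ×ˢ (extChartAt 𝓘(ℝ, E3) q).target) := by
  have := (isCayleyEvolution_iff.1 h).2.analyticOnNhd_inChart isOpen_univ q
  rwa [preimage_univ, inter_univ] at this

theorem IsCayleyEvolution.injective_mfderiv_iff (h : IsCayleyEvolution χ ψ₀ ε ψ) {q p : P}
    (hp : p ∈ (chartAt E3 q).source) {t : ℝ} (ht : t ∈ Ioo (-ε) ε) :
    Function.Injective (mfderiv 𝓘(ℝ, E3) 𝓘(ℝ, E8) (ψ t) p) ↔
      Function.Injective (spaceDeriv (inChart ψ q) (t, extChartAt 𝓘(ℝ, E3) q p)) := by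
  have hps : p ∈ (extChartAt 𝓘(ℝ, E3) q).source := by simpa using hp
  obtain ⟨e, he⟩ : (mfderiv 𝓘(ℝ, E3) 𝓘(ℝ, E3) (extChartAt 𝓘(ℝ, E3) q) p).IsInvertible :=
    isInvertible_mfderiv_extChartAt hps
  have hd := (h.analyticOnNhd_inChart q (t, extChartAt 𝓘(ℝ, E3) q p)
    ⟨ht, (extChartAt 𝓘(ℝ, E3) q).map_source hps⟩).differentiableAt
  have h1 : fderiv ℝ (ψ t ∘ (extChartAt 𝓘(ℝ, E3) q).symm) (extChartAt 𝓘(ℝ, E3) q p) =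
      spaceDeriv (inChart ψ q) (t, extChartAt 𝓘(ℝ, E3) q p) := (hasFDerivAt_spaceDeriv hd).fderiv
  rw [mfderiv_eq_fderiv_comp_mfderiv_extChartAt hp
    ((isCayleyEvolution_iff.1 h).2.mdifferentiableAt isOpen_univ ht (mem_univ p)), h1, ← he]
  exact Function.Injective.of_comp_iff' (spaceDeriv (inChart ψ q) _) e.bijective

/-- The maps `ψ t` are immersions for small `t`, since injectivity of the differential is an open
condition and `P` is compact. -/
theorem IsCayleyEvolution.eventually_injective_mfderiv [CompactSpace P]
    (h : IsCayleyEvolution χ ψ₀ ε ψ) (hε : 0 < ε)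
    (himm : ∀ p, Function.Injective (mfderiv 𝓘(ℝ, E3) 𝓘(ℝ, E8) ψ₀ p)) :
    ∀ᶠ t in 𝓝 (0 : ℝ), ∀ p, Function.Injective (mfderiv 𝓘(ℝ, E3) 𝓘(ℝ, E8) (ψ t) p) := by
  have h0 : (0 : ℝ) ∈ Ioo (-ε) ε := ⟨by simpa, hε⟩
  have key : ∀ᶠ t in 𝓝 (0 : ℝ), ∀ p ∈ (univ : Set P),
      Function.Injective (mfderiv 𝓘(ℝ, E3) 𝓘(ℝ, E8) (ψ t) p) := by
    refine isCompact_univ.eventually_forall_of_forall_eventually fun q _ => ?_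
    have hqs : q ∈ (extChartAt 𝓘(ℝ, E3) q).source := mem_extChartAt_source q
    have hz : ((0 : ℝ), extChartAt 𝓘(ℝ, E3) q q) ∈
        Ioo (-ε) ε ×ˢ (extChartAt 𝓘(ℝ, E3) q).target :=
      ⟨h0, (extChartAt 𝓘(ℝ, E3) q).map_source hqs⟩
    have hc : ContinuousAt (fun x : ℝ × P =>
        spaceDeriv (inChart ψ q) (x.1, extChartAt 𝓘(ℝ, E3) q x.2)) (0, q) :=
      ContinuousAt.comp (f := fun x : ℝ × P => (x.1, extChartAt 𝓘(ℝ, E3) q x.2)) (x := (0, q))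
        ((h.analyticOnNhd_inChart q).spaceDeriv _ hz).continuousAt
        (continuousAt_fst.prodMk (ContinuousAt.comp (x := ((0 : ℝ), q))
          (continuousAt_extChartAt (I := 𝓘(ℝ, E3)) q) continuousAt_snd))
    have hi : Function.Injective (spaceDeriv (inChart ψ q) (0, extChartAt 𝓘(ℝ, E3) q q)) := by
      rw [← h.injective_mfderiv_iff (mem_chart_source E3 q) h0, h.initial]
      exact himm q
    have hn : Ioo (-ε) ε ×ˢ (chartAt E3 q).source ∈ 𝓝 ((0 : ℝ), q) :=
      (isOpen_Ioo.prod (chartAt E3 q).open_source).mem_nhds ⟨h0, mem_chart_source E3 q⟩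
    filter_upwards [hc.eventually (ContinuousLinearMap.isOpen_injective.mem_nhds hi), hn]
      with x hx1 hx2
    exact (h.injective_mfderiv_iff hx2.2 hx2.1).2 hx1
  filter_upwards [key] with t ht p using ht p (mem_univ p)

/-- The map `(t, p) ↦ ψ t p` is injective near the points where `ψ t` is an immersion, because its
differential is injective there. -/
theorem IsCayleyEvolution.exists_injOn_nhds (h : IsCayleyEvolution χ ψ₀ ε ψ) {t : ℝ}
    (ht : t ∈ Ioo (-ε) ε) (q : P) (hχ : χ q ≠ 0)
    (hinj : Function.Injective (mfderiv 𝓘(ℝ, E3) 𝓘(ℝ, E8) (ψ t) q)) :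
    ∃ s ∈ 𝓝 (t, q), InjOn (fun x : ℝ × P => ψ x.1 x.2) s := by
  have hqs : q ∈ (extChartAt 𝓘(ℝ, E3) q).source := mem_extChartAt_source q
  have hqt := (extChartAt 𝓘(ℝ, E3) q).map_source hqs
  have hinv := (extChartAt 𝓘(ℝ, E3) q).left_inv hqs
  have ha := h.analyticOnNhd_inChart q (t, extChartAt 𝓘(ℝ, E3) q q) ⟨ht, hqt⟩
  rw [h.injective_mfderiv_iff (mem_chart_source E3 q) ht] at hinj
  have htime := (isCayleyEvolution_iff.1 h).2.timeDeriv_inChart isOpen_univ q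
    (z := (t, extChartAt 𝓘(ℝ, E3) q q)) ⟨ht, hqt, mem_univ _⟩
  rw [hinv] at htime
  have hfd : Function.Injective
      (fderiv ℝ (inChart ψ q) (t, extChartAt 𝓘(ℝ, E3) q q)).toLinearMap := by
    refine injective_of_eq_smul_frameCross_add
      (A := (spaceDeriv (inChart ψ q) (t, extChartAt 𝓘(ℝ, E3) q q)).toLinearMap)
      hinj (chartCoeff_ne_zero (mem_chart_source E3 q) hχ) fun s v => ?_
    have hsv : ((s, v) : ℝ × E3) = s • (1, 0) + (0, v) := by simp
    rw [hsv, map_add, map_smul]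
    exact congrArg (fun y => s • y + spaceDeriv (inChart ψ q) _ v) htime
  obtain ⟨s, hs, hsi⟩ := ha.hasStrictFDerivAt.exists_injOn_of_injective hfd
  have hc : ContinuousAt (fun x : ℝ × P => (x.1, extChartAt 𝓘(ℝ, E3) q x.2)) (t, q) :=
    continuousAt_fst.prodMk (ContinuousAt.comp (x := (t, q))
      (continuousAt_extChartAt (I := 𝓘(ℝ, E3)) q) continuousAt_snd)
  refine ⟨_, inter_mem (hc hs) (prod_mem_nhds univ_mem
    (extChartAt_source_mem_nhds (I := 𝓘(ℝ, E3)) q)), ?_⟩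
  rintro ⟨a, x⟩ ⟨hx1, -, hx2⟩ ⟨b, y⟩ ⟨hy1, -, hy2⟩ hxy
  have heq := hsi hx1 hy1 (by
    simp only [inChart, (extChartAt 𝓘(ℝ, E3) q).left_inv hx2,
      (extChartAt 𝓘(ℝ, E3) q).left_inv hy2]
    exact hxy)
  exact Prod.ext (Prod.ext_iff.1 heq).1
    ((extChartAt 𝓘(ℝ, E3) q).injOn hx2 hy2 (Prod.ext_iff.1 heq).2)

/-- If `ψ₀` is injective then so is `(t, p) ↦ ψ t p` for small times. Pairs of distinct points
stay apart by continuity, and points close to each other do not collide because `(t, p) ↦ ψ t p`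
is an immersion. -/
theorem IsCayleyEvolution.exists_injOn [CompactSpace P]
    (h : IsCayleyEvolution χ ψ₀ ε ψ) (hε : 0 < ε) (hχ : ∀ p, χ p ≠ 0)
    (himm : ∀ p, Function.Injective (mfderiv 𝓘(ℝ, E3) 𝓘(ℝ, E8) ψ₀ p))
    (hinj : Function.Injective ψ₀) :
    ∃ δ > 0, InjOn (fun x : ℝ × P => ψ x.1 x.2) (Ioo (-δ) δ ×ˢ univ) := by
  have h0 : (0 : ℝ) ∈ Ioo (-ε) ε := ⟨by simpa, hε⟩
  have key : ∀ᶠ z in 𝓝 ((0 : ℝ), (0 : ℝ)), ∀ y ∈ (univ : Set (P × P)),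
      ψ z.1 y.1 = ψ z.2 y.2 → (z.1, y.1) = (z.2, y.2) := by
    refine isCompact_univ.eventually_forall_of_forall_eventually fun y _ => ?_
    obtain ⟨p, q⟩ := y
    have hp : Tendsto (fun w : (ℝ × ℝ) × (P × P) => (w.1.1, w.2.1)) (𝓝 ((0, 0), (p, q)))
        (𝓝 (0, p)) := Continuous.tendsto (by fun_prop) ((0, 0), (p, q))
    have hq : Tendsto (fun w : (ℝ × ℝ) × (P × P) => (w.1.2, w.2.2)) (𝓝 ((0, 0), (p, q)))
        (𝓝 (0, q)) := Continuous.tendsto (by fun_prop) ((0, 0), (p, q))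
    rcases eq_or_ne p q with rfl | hpq
    · obtain ⟨s, hs, hsi⟩ := h.exists_injOn_nhds h0 p (hχ p) (by rw [h.initial]; exact himm p)
      filter_upwards [hp hs, hq hs] with w hw1 hw2 heq using hsi hw1 hw2 heq
    · have hne : ψ 0 p ≠ ψ 0 q := by
        rw [h.initial]
        exact hinj.ne hpq
      have hlim := ((h.continuousAt h0 p).tendsto.comp hp).prodMk_nhds
        ((h.continuousAt h0 q).tendsto.comp hq)
      have hev := hlim.eventually (isOpen_ne_fun continuous_fst continuous_snd |>.mem_nhds hne)
      filter_upwards [hev] with w hw heq using absurd heq hw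
  obtain ⟨δ, hδ, hs⟩ := Metric.eventually_nhds_iff_ball.1 key
  refine ⟨δ, hδ, fun x hx y hy hxy => hs (x.1, y.1) ?_ (x.2, y.2) (mem_univ _) hxy⟩
  rw [← ball_prod_same, Real.ball_eq_Ioo, zero_sub, zero_add]
  exact ⟨hx.1, hy.1⟩

end SmallTimes

theorem theorem3p6 {P : Type*} [TopologicalSpace P] [T2Space P] [CompactSpace P]
    [ChartedSpace E3 P] [IsManifold 𝓘(ℝ, E3) ω P]
    (χ : (p : P) → ⋀[ℝ]^3 (TangentSpace 𝓘(ℝ, E3) p))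
    (hχ : IsAnalyticSection χ) (hχ0 : ∀ p, χ p ≠ 0)
    (ψ₀ : P → E8) (hψ₀ : ContMDiff 𝓘(ℝ, E3) 𝓘(ℝ, E8) ω ψ₀)
    (himm : ∀ p, Function.Injective (mfderiv 𝓘(ℝ, E3) 𝓘(ℝ, E8) ψ₀ p)) :
    ∃ ε > 0, ∃ ψ : ℝ → P → E8,
      IsCayleyEvolution χ ψ₀ ε ψ ∧
      (∀ ψ' : ℝ → P → E8, IsCayleyEvolution χ ψ₀ ε ψ' → ∀ t ∈ Ioo (-ε) ε, ψ' t = ψ t) ∧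
      IsImmersedCayleyOn (𝓘(ℝ, ℝ).prod 𝓘(ℝ, E3)) (fun x : ℝ × P => ψ x.1 x.2)
        (Ioo (-ε) ε ×ˢ univ) ∧
      (IsEmbedding ψ₀ →
        IsEmbeddedCayleyOn (𝓘(ℝ, ℝ).prod 𝓘(ℝ, E3)) (fun x : ℝ × P => ψ x.1 x.2)
          (Ioo (-ε) ε ×ˢ univ)) := by
  obtain ⟨ε₁, hε₁, ψ, hψ⟩ := exists_isCayleyEvolution hχ hψ₀
  obtain ⟨ε₂, hε₂, hinj⟩ :=
    exists_Ioo_subset_of_mem_nhds_zero (hψ.eventually_injective_mfderiv hε₁ himm)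
  obtain ⟨ε₃, hε₃, hemb⟩ : ∃ ε₃ > 0, IsEmbedding ψ₀ → ∀ ε ≤ ε₃, IsEmbedding
      ((Ioo (-ε) ε ×ˢ (univ : Set P)).domRestrict fun x : ℝ × P => ψ x.1 x.2) := by
    by_cases h0 : IsEmbedding ψ₀
    · obtain ⟨δ, hδ, hδi⟩ := hψ.exists_injOn hε₁ hχ0 himm h0.injective
      have hmin : 0 < min δ ε₁ := lt_min hδ hε₁
      refine ⟨min δ ε₁ / 2, half_pos hmin, fun _ ε hε => ?_⟩
      refine (hψ.mono (min_le_right δ ε₁)).isEmbedding_domRestrict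
        (hε.trans_lt (half_lt_self hmin))
        (hδi.mono (Set.prod_mono (Ioo_subset_Ioo ?_ ?_) Subset.rfl))
      · exact neg_le_neg (min_le_left δ ε₁)
      · exact min_le_left δ ε₁
    -- If `ψ₀` is not an embedding, the condition on `ε₃` is void.
    · exact ⟨1, one_pos, fun h => absurd h h0⟩
  have h1 : min ε₁ (min ε₂ ε₃) ≤ ε₁ := min_le_left _ _
  have h2 : min ε₁ (min ε₂ ε₃) ≤ ε₂ := (min_le_right _ _).trans (min_le_left _ _)
  have h3 : min ε₁ (min ε₂ ε₃) ≤ ε₃ := (min_le_right _ _).trans (min_le_right _ _)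
  have hε : 0 < min ε₁ (min ε₂ ε₃) := lt_min hε₁ (lt_min hε₂ hε₃)
  have hev := hψ.mono h1
  have hcay := hev.isImmersedCayleyOn hχ0 fun t ht p =>
    hinj t (Ioo_subset_Ioo (neg_le_neg h2) h2 ht) p
  exact ⟨_, hε, ψ, hev, fun ψ' hψ' t ht => hev.eq hψ' hε ht, hcay,
    fun h0 => ⟨hcay, hemb h0 _ h3⟩⟩
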